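/- For $n\ge 2$, an increasing factorisation of size $n$ is a sequence $(\tau_1,\dots,\tau_{n-1})$ of transpositions of $\{1,\dots,n\}$ with $\tau_{n-1}\circ\cdots\circ\tau_1=(1\,2\,\cdots\,n)$ such that, writing $\tau_i=(a_i\ b_i)$ with $a_i<b_i$, one has $a_1\le a_2\le\cdots\le a_{n-1}$. For every $n\ge2$, let $(\tau_1,\dots,\tau_{n-1})$ be an increasing factorisation of size $n$ chosen uniformly at random, with $\tau_i=(a_i\ b_i)$ and $a_i<b_i$ (the dependence on $n$ being suppressed in the notation). Then: 1. For every $n\ge 2$, almost surely the sets $\{a_1,\dots,a_{n-1}\}$ and $\{b_1,\dots,b_{n-1}\}$ are disjoint and their union is $\{1,2,\dots,n\}$. 2. For every $n\ge2$ and every $k\in\{1,\dots,n-1\}$, $$\mathbb P\bigl(\#\{a_1,\dots,a_{n-1}\}=k\bigr)=\frac{n}{n-1}\binom{n-1}{k}\binom{n-1}{k-1}\binom{2n-2}{n-1}^{-1}.$$ 3. As $n\to\infty$, $$\frac{\#\{a_1,\dots,a_{n-1}\}-n/2}{\sqrt n}\longrightarrow\mathcal N(0,1/8)$$ in distribution,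 where $\mathcal N(0,1/8)$ is the centred normal distribution with variance $1/8$. -/

import Mathlib

open MeasureTheory ProbabilityTheory Filter

/-- The finite set of permutations of `Fin n` carries the discrete σ-algebra. -/
instance permFinMeasurableSpace (n : ℕ) : MeasurableSpace (Equiv.Perm (Fin n)) := ⊤

instance permFinDiscreteMeasurableSpace (n : ℕ) :
    DiscreteMeasurableSpace (Equiv.Perm (Fin n)) := ⟨fun _ => trivial⟩

/-- Minimal factorisations of size `n`: sequences `(τ_1, …, τ_{n-1})` of transpositions with
`τ_{n-1} ∘ ⋯ ∘ τ_1 = (1 2 … n)`. The label `j ∈ {1, …, n}` is the element `j - 1` of `Fin n`, and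
`τ_j` is `τ` at the element `j - 1` of `Fin (n - 1)`; `finRotate n` is the cycle `(1 2 … n)`. -/
def minimalFactorisations (n : ℕ) : Set (Fin (n - 1) → Equiv.Perm (Fin n)) :=
  {τ | (∀ i, (τ i).IsSwap) ∧ (List.ofFn τ).reverse.prod = finRotate n}

/-- Increasing factorisations of size `n`: minimal factorisations such that, writing
`τ_i = (a_i b_i)` with `a_i < b_i`, one has `a_1 ≤ a_2 ≤ ⋯ ≤ a_{n-1}`. -/
def increasingFactorisations (n : ℕ) : Set (Fin (n - 1) → Equiv.Perm (Fin n)) :=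
  {τ | τ ∈ minimalFactorisations n ∧
    ∀ i j : Fin (n - 1), i ≤ j → ∀ a b a' b' : Fin n, a < b → a' < b' →
      τ i = Equiv.swap a b → τ j = Equiv.swap a' b' → a ≤ a'}

/-- The set `{a_1, …, a_{n-1}}`, where `τ_i = (a_i b_i)` with `a_i < b_i`. -/
def leftEnds {n : ℕ} (τ : Fin (n - 1) → Equiv.Perm (Fin n)) : Set (Fin n) :=
  {a | ∃ i, ∃ b, a < b ∧ τ i = Equiv.swap a b}

/-- The set `{b_1, …, b_{n-1}}`, where `τ_i = (a_i b_i)` with `a_i < b_i`. -/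
def rightEnds {n : ℕ} (τ : Fin (n - 1) → Equiv.Perm (Fin n)) : Set (Fin n) :=
  {b | ∃ i, ∃ a, a < b ∧ τ i = Equiv.swap a b}

theorem star_prod_apply (m j : ℕ) (hj : j ≤ m) (x : Fin (m + 1)) :
    ((((List.ofFn (fun i : Fin j =>
      Equiv.swap (0 : Fin (m + 1)) ⟨i.1 + 1, by omega⟩)).reverse.prod) x : Fin (m + 1)) : ℕ)
      = if x.1 < j then x.1 + 1 else if x.1 = j then 0 else x.1 := by
  induction j with
  | zero =>
    simp only [List.ofFn_zero, List.reverse_nil, List.prod_nil, Equiv.Perm.coe_one, id]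
    split_ifs <;> omega
  | succ j ih =>
    have h := ih (by omega)
    rw [List.ofFn_succ', List.concat_eq_append, List.reverse_append, List.reverse_singleton,
      List.singleton_append, List.prod_cons, Equiv.Perm.mul_apply]
    simp only [Fin.val_castSucc, Fin.val_last]
    rw [Equiv.swap_apply_def]
    simp only [Fin.ext_iff, Fin.val_zero]
    split_ifs at h ⊢ <;> (try simp only [Fin.val_zero]) <;> omega

/-- There is an increasing factorisation of every size, namely `((1 2), (1 3), …, (1 n))`, so
that the uniform distribution makes sense. -/
theorem increasingFactorisations_nonempty (n : ℕ) : (increasingFactorisations n).Nonempty := by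
  cases n with
  | zero => exact ⟨Fin.elim0, ⟨⟨fun i => i.elim0, by ext x; exact x.elim0⟩, fun i => i.elim0⟩⟩
  | succ m =>
    refine ⟨fun i : Fin m => Equiv.swap (0 : Fin (m + 1)) ⟨i.1 + 1, by omega⟩,
      ⟨fun i => ⟨_, _, ?_, rfl⟩, ?_⟩, ?_⟩
    · simp [Fin.ext_iff]
    · ext x
      refine (star_prod_apply m m le_rfl x).trans ?_
      rw [coe_finRotate]
      have := x.2
      simp only [Fin.ext_iff, Fin.val_last]
      split_ifs <;> omega
    · intro i j _ a b a' b' hab _ hi _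
      have h0 : a = 0 := by
        by_contra h
        have hb : b ≠ 0 := fun hb => by simp [hb] at hab
        have h1 : Equiv.swap (0 : Fin (m + 1)) ⟨i.1 + 1, Nat.succ_lt_succ i.2⟩ 0 =
          Equiv.swap a b 0 := congrArg (fun σ : Equiv.Perm (Fin (m + 1)) => σ 0) hi
        rw [Equiv.swap_apply_left, Equiv.swap_apply_of_ne_of_ne (Ne.symm h) (Ne.symm hb)] at h1
        exact absurd (congrArg Fin.val h1) (Nat.succ_ne_zero i.1)
      simp [h0]

/-- The uniform distribution on the increasing factorisations of size `n`. -/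
noncomputable def uniformIncreasing (n : ℕ) : Measure (Fin (n - 1) → Equiv.Perm (Fin n)) :=
  uniformOn (increasingFactorisations n)

instance uniformIncreasing_isProbabilityMeasure (n : ℕ) :
    IsProbabilityMeasure (uniformIncreasing n) :=
  isProbabilityMeasure_uniformOn (Set.toFinite _) (increasingFactorisations_nonempty n)

/-!
An increasing factorisation is encoded by the list of the pairs `(a, b)`, `a < b`, of its
transpositions, and factorisations of the cycle that runs increasingly through an arbitrary finite
subset `s` of a finite linear order are studied at once (`IsIncFact`).

*Decomposition.* The first transposition is `(m b)` with `m = min s`, as some transposition has to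
move `m` and the first entries increase. Composing the cycle with `(m b)` cuts it into the increasing
cycles on `A = {m} ∪ {x ∈ s | b < x}` and on `B = {x ∈ s | m < x ≤ b}`. Since the remaining
`#A + #B - 2` transpositions are as few as possible, none of them links `A` to `B`: identifying the
ends of `r` pairs leaves at least `#s - r` classes (`exists_invariant_map`), while the orbits `A` and
`B` would be merged into one. So the remaining transpositions form increasing factorisations of the
two smaller cycles (`IsIncFact.split`). Conversely two such factorisations can be shuffled in one way
only, because first entries in `B` come after `m` and before the other elements of `A`
(`IsIncFact.cons_shuffle`). Disjointness of the left ends and the right ends and the fact that they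
cover `s` follow by induction.

*Counting.* The decomposition gives a convolution recurrence for the generating polynomial of the
number of left ends (`leftPoly_eq_sum`). The Narayana polynomials satisfy the same recurrence: it
amounts to the quadratic equation `T = x + T (T - x + x y)` for their generating function, that is
to `S ^ 2 = D` for `S = 2 T - 1 - x (1 - y)` and `D` a polynomial of degree two in `x`. By the
three-term recurrence of the Narayana polynomials (`narayana_rec`) both `S ^ 2` and `D` solve
`D E' = D' E`, and they agree at `x = 0` (`narayana_eq_sum_antidiagonal`).

*Limit.* With `m = n - 1`, the number `k` of left ends thus has probability
`C(m, k) C(m, k - 1) / C(2 m, m - 1)`, a hypergeometric distribution. The de Moivre–Laplace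
asymptotics of binomial coefficients, from Stirling's formula, turn this into a local limit theorem
(`tendsto_sqrt_mul_uniformIncreasing_real`), and Scheffé's lemma, applied to the densities that are
constant on the cells of the lattice, into convergence in distribution
(`tendsto_integral_of_local_limit`).
-/

/-! ### Products of transpositions and increasing cycles -/

section cycles

variable {α : Type*} [LinearOrder α]

/-- `swapProd [(a₁, b₁), …, (aᵣ, bᵣ)]` is the permutation `(aᵣ bᵣ) ∘ ⋯ ∘ (a₁ b₁)`. -/
def swapProd : List (α × α) → Equiv.Perm α
  | [] => 1
  | p :: l => swapProd l * Equiv.swap p.1 p.2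

/-- `y` is the cyclic successor of `x` in `s`: the next larger element of `s`, or the least element
of `s` if there is none larger than `x`. -/
def IsCyclicSucc (s : Finset α) (x y : α) : Prop :=
  y ∈ s ∧ ((x < y ∧ ∀ z ∈ s, x < z → y ≤ z) ∨ ((∀ z ∈ s, z ≤ x) ∧ ∀ z ∈ s, y ≤ z))

/-- `l` encodes a minimal factorisation, increasing in the first entries, of the cycle that runs
through `s` in increasing order: the pair `(a, b)` stands for the transposition of `a < b`. -/
structure IsIncFact (s : Finset α) (l : List (α × α)) : Prop where
  lt : ∀ p ∈ l, p.1 < p.2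
  left_mem : ∀ p ∈ l, p.1 ∈ s
  right_mem : ∀ p ∈ l, p.2 ∈ s
  length : l.length + 1 = s.card
  sorted : l.Pairwise (fun p q => p.1 ≤ q.1)
  fix : ∀ x ∉ s, swapProd l x = x
  succ : ∀ x ∈ s, IsCyclicSucc s x (swapProd l x)

/-- The finite set of first entries of a list of pairs. -/
def lefts (l : List (α × α)) : Finset α := (l.map Prod.fst).toFinset

/-- The finite set of second entries of a list of pairs. -/
def rights (l : List (α × α)) : Finset α := (l.map Prod.snd).toFinset

/-- `m` together with the elements of `s` above `b`; meant for `m = min s` and `b ∈ s`, where it is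
one of the two orbits into which the transposition of `m` and `b` cuts the cycle on `s`. -/
def outerPart (s : Finset α) (m b : α) : Finset α := s.filter (fun x => x = m ∨ b < x)

/-- The elements of `s` in the half-open interval `(m, b]`, the other of the two orbits. -/
def innerPart (s : Finset α) (m b : α) : Finset α := s.filter (fun x => m < x ∧ x ≤ b)

theorem IsCyclicSucc.unique {s : Finset α} {x y z : α} (hy : IsCyclicSucc s x y)
    (hz : IsCyclicSucc s x z) : y = z := by
  obtain ⟨hys, hy⟩ := hy
  obtain ⟨hzs, hz⟩ := hz
  apply le_antisymm <;> grind

/-- If no transposition of `l` links `A` to its complement, `A` is stable under the product, which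
acts on `A` as the product of the transpositions of `l` that lie in `A`. -/
theorem swapProd_filter_of_mem {A : Finset α} {l : List (α × α)} (hl : ∀ p ∈ l, p.1 ∈ A ↔ p.2 ∈ A)
    {x : α} (hx : x ∈ A) :
    swapProd (l.filter (fun p => p.1 ∈ A)) x = swapProd l x ∧ swapProd l x ∈ A := by
  induction l generalizing x with
  | nil => simpa [swapProd] using hx
  | cons p l ih =>
    have ih' := fun x hx => @ih (fun q hq => hl q (List.mem_cons_of_mem _ hq)) x hx
    have hp := hl p List.mem_cons_self
    by_cases h : p.1 ∈ A
    · have : Equiv.swap p.1 p.2 x ∈ A := by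
        rw [Equiv.swap_apply_def]; grind
      simpa [List.filter_cons, h, swapProd] using ih' _ this
    · have : Equiv.swap p.1 p.2 x = x :=
        Equiv.swap_apply_of_ne_of_ne (by grind) (by grind)
      simpa [List.filter_cons, h, swapProd, this] using ih' _ hx

theorem swapProd_apply_of_forall_ne {l : List (α × α)} {x : α}
    (hl : ∀ p ∈ l, x ≠ p.1 ∧ x ≠ p.2) : swapProd l x = x := by
  induction l with
  | nil => rfl
  | cons p l ih =>
    have hp := hl p List.mem_cons_self
    rw [swapProd, Equiv.Perm.mul_apply, Equiv.swap_apply_of_ne_of_ne hp.1 hp.2]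
    exact ih fun q hq => hl q (List.mem_cons_of_mem _ hq)

/-- Identifying the two ends of each of the pairs of `l` leaves at least `#s - l.length` classes
in `s`; `f` chooses a representative of each class. -/
theorem exists_invariant_map (s : Finset α) (l : List (α × α)) :
    ∃ f : α → α, (∀ p ∈ l, f p.1 = f p.2) ∧ s.card ≤ (s.image f).card + l.length := by
  induction l with
  | nil => exact ⟨id, by simp, by simp⟩
  | cons p l ih =>
    obtain ⟨f, hf, hc⟩ := ih
    refine ⟨fun x => if f x = f p.1 then f p.2 else f x, ?_, ?_⟩
    · intro q hq
      rcases List.mem_cons.1 hq with rfl | hq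
      · by_cases h : f q.2 = f q.1 <;> simp [h]
      · simp [hf q hq]
    · have : (s.image f).erase (f p.1) ⊆
          s.image (fun x => if f x = f p.1 then f p.2 else f x) := by
        intro y hy
        simp only [Finset.mem_erase, Finset.mem_image] at hy ⊢
        obtain ⟨hne, x, hx, rfl⟩ := hy
        exact ⟨x, hx, by simp [hne]⟩
      have h1 := Finset.card_le_card this
      have h2 := Finset.pred_card_le_card_erase (s := s.image f) (a := f p.1)
      simp only [List.length_cons]
      omega

theorem apply_swapProd_of_invariant {β : Type*} {f : α → β} {l : List (α × α)}
    (hf : ∀ p ∈ l, f p.1 = f p.2) (x : α) : f (swapProd l x) = f x := by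
  induction l generalizing x with
  | nil => rfl
  | cons p l ih =>
    rw [swapProd, Equiv.Perm.mul_apply, ih fun q hq => hf q (List.mem_cons_of_mem _ hq)]
    have hp := hf p List.mem_cons_self
    rw [Equiv.swap_apply_def]
    split_ifs <;> simp_all

theorem eq_of_forall_isCyclicSucc [Finite α] {β : Type*} {f : α → β} {g : α → α} {A : Finset α}
    (hg : ∀ x ∈ A, IsCyclicSucc A x (g x)) (hf : ∀ x, f (g x) = f x) {x y : α}
    (hx : x ∈ A) (hy : y ∈ A) : f x = f y := by
  have key : ∀ x, x ∈ A → f x = f (A.max' ⟨y, hy⟩) := by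
    intro x
    induction x using WellFoundedGT.induction with
    | ind x ih =>
      intro hx
      rcases hg x hx with ⟨h1, h2 | h2⟩
      · rw [← hf x]; exact ih _ h2.1 h1
      · rw [le_antisymm (h2.1 _ (A.max'_mem ⟨y, hy⟩)) (A.le_max' x hx)]
  rw [key x hx, key y hy]

/-- A product of transpositions that permutes `A` cyclically has at least `#A - 1` factors. -/
theorem card_le_of_forall_isCyclicSucc [Finite α] {A : Finset α} {l : List (α × α)}
    (h : ∀ x ∈ A, IsCyclicSucc A x (swapProd l x)) : A.card ≤ l.length + 1 := by
  obtain ⟨f, hf, hc⟩ := exists_invariant_map A l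
  have : (A.image f).card ≤ 1 := by
    rw [Finset.card_le_one]
    simp only [Finset.mem_image]
    rintro _ ⟨x, hx, rfl⟩ _ ⟨y, hy, rfl⟩
    exact eq_of_forall_isCyclicSucc h (apply_swapProd_of_invariant hf) hx hy
  omega

/-- In a product of `#A + #B - 2` transpositions with the two orbits `A` and `B`, no transposition
links `A` to `B`: otherwise identifying the ends of the transpositions would leave one class. -/
theorem mem_iff_mem_of_two_cycles [Finite α] {s A B : Finset α} {l : List (α × α)}
    (hs : ∀ x, x ∈ s ↔ x ∈ A ∨ x ∈ B) (hlen : l.length + 2 ≤ s.card)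
    (hleft : ∀ p ∈ l, p.1 ∈ s) (hright : ∀ p ∈ l, p.2 ∈ s)
    (hA : ∀ x ∈ A, IsCyclicSucc A x (swapProd l x))
    (hB : ∀ x ∈ B, IsCyclicSucc B x (swapProd l x)) :
    ∀ p ∈ l, p.1 ∈ A ↔ p.2 ∈ A := by
  obtain ⟨f, hf, hc⟩ := exists_invariant_map s l
  have hfA := fun x hx y hy => @eq_of_forall_isCyclicSucc _ _ _ _ f _ _ hA
    (apply_swapProd_of_invariant hf) x y hx hy
  have hfB := fun x hx y hy => @eq_of_forall_isCyclicSucc _ _ _ _ f _ _ hB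
    (apply_swapProd_of_invariant hf) x y hx hy
  by_contra! hcon
  obtain ⟨p, hp, hcon⟩ := hcon
  have hex : ∃ a ∈ A, ∃ b ∈ B, f a = f b := by
    have h1 := (hs _).1 (hleft p hp)
    have h2 := (hs _).1 (hright p hp)
    have h3 := hf p hp
    by_cases h : p.1 ∈ A
    · exact ⟨p.1, h, p.2, by grind, h3⟩
    · exact ⟨p.2, by grind, p.1, by grind, h3.symm⟩
  obtain ⟨a, ha, b, hb, hab⟩ := hex
  have : (s.image f).card ≤ 1 := by
    rw [Finset.card_le_one]
    simp only [Finset.mem_image]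
    have : ∀ x ∈ s, f x = f a := by
      intro x hx
      rcases (hs x).1 hx with h | h
      · exact hfA x h a ha
      · rw [hab]; exact hfB x h b hb
    rintro _ ⟨x, hx, rfl⟩ _ ⟨y, hy, rfl⟩
    rw [this x hx, this y hy]
  omega

section split

variable {s : Finset α} {m b : α}

theorem mem_outerPart {x : α} : x ∈ outerPart s m b ↔ x ∈ s ∧ (x = m ∨ b < x) := by simp [outerPart]

theorem mem_innerPart {x : α} : x ∈ innerPart s m b ↔ x ∈ s ∧ m < x ∧ x ≤ b := by simp [innerPart]

theorem disjoint_outerPart_innerPart : Disjoint (outerPart s m b) (innerPart s m b) := by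
  rw [Finset.disjoint_left]
  intro x
  rw [mem_outerPart, mem_innerPart]
  grind

theorem mem_iff_outerPart_or_innerPart (hm : ∀ x ∈ s, m ≤ x) (x : α) :
    x ∈ s ↔ x ∈ outerPart s m b ∨ x ∈ innerPart s m b := by
  rw [mem_outerPart, mem_innerPart]
  grind

theorem card_outerPart_add_card_innerPart (hm : ∀ x ∈ s, m ≤ x) :
    (outerPart s m b).card + (innerPart s m b).card = s.card := by
  rw [← Finset.card_union_of_disjoint disjoint_outerPart_innerPart]
  congr 1
  ext x
  rw [Finset.mem_union, ← mem_iff_outerPart_or_innerPart hm]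

theorem isCyclicSucc_outerPart_min_iff (hms : m ∈ s) (hm : ∀ x ∈ s, m ≤ x)
    (hmb : m < b) {y : α} : IsCyclicSucc (outerPart s m b) m y ↔ IsCyclicSucc s b y := by
  simp only [IsCyclicSucc, mem_outerPart]
  constructor
  · rintro ⟨⟨h1, h2⟩, h | h⟩
    · refine ⟨h1, Or.inl ⟨by grind, fun z hz hz' => h.2 z ⟨hz, Or.inr hz'⟩ (by grind)⟩⟩
    · have : y = m := le_antisymm (h.2 m ⟨hms, Or.inl rfl⟩) (hm y h1)
      refine ⟨h1, Or.inr ⟨fun z hz => ?_, fun z hz => this ▸ hm z hz⟩⟩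
      by_contra! hlt
      exact absurd (h.1 z ⟨hz, Or.inr hlt⟩) (by grind)
  · rintro ⟨h1, h | h⟩
    · exact ⟨⟨h1, Or.inr h.1⟩, Or.inl ⟨by grind, fun z hz hz' => h.2 z hz.1 (by grind)⟩⟩
    · have : y = m := le_antisymm (h.2 m hms) (hm y h1)
      exact ⟨⟨h1, Or.inl this⟩, Or.inr ⟨fun z hz => by grind, fun z hz => h.2 z hz.1⟩⟩

theorem isCyclicSucc_outerPart_iff (hms : m ∈ s) (hm : ∀ x ∈ s, m ≤ x)
    {x y : α} (hbx : b < x) :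
    IsCyclicSucc (outerPart s m b) x y ↔ IsCyclicSucc s x y := by
  simp only [IsCyclicSucc, mem_outerPart]
  constructor
  · rintro ⟨⟨h1, h2⟩, h | h⟩
    · exact ⟨h1, Or.inl ⟨h.1, fun z hz hz' => h.2 z ⟨hz, by grind⟩ hz'⟩⟩
    · exact ⟨h1, Or.inr ⟨fun z hz => by grind, fun z hz => (h.2 m ⟨hms, Or.inl rfl⟩).trans (hm z hz)⟩⟩
  · rintro ⟨h1, h | h⟩
    · exact ⟨⟨h1, by grind⟩, Or.inl ⟨h.1, fun z hz hz' => h.2 z hz.1 hz'⟩⟩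
    · have : y = m := le_antisymm (h.2 m hms) (hm y h1)
      exact ⟨⟨h1, Or.inl this⟩, Or.inr ⟨fun z hz => h.1 z hz.1, fun z hz => h.2 z hz.1⟩⟩

theorem isCyclicSucc_innerPart_max_iff (hbs : b ∈ s)
    (hmb : m < b) {y : α} : IsCyclicSucc (innerPart s m b) b y ↔ IsCyclicSucc s m y := by
  simp only [IsCyclicSucc, mem_innerPart]
  constructor
  · rintro ⟨⟨h1, h2⟩, h | h⟩
    · grind
    · refine ⟨h1, Or.inl ⟨h2.1, fun z hz hz' => ?_⟩⟩
      rcases le_or_gt z b with hzb | hzb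
      · exact h.2 z ⟨hz, hz', hzb⟩
      · grind
  · rintro ⟨h1, h | h⟩
    · exact ⟨⟨h1, h.1, h.2 b hbs hmb⟩, Or.inr ⟨by grind, fun z hz => h.2 z hz.1 hz.2.1⟩⟩
    · exact absurd (h.1 b hbs) (by grind)

theorem isCyclicSucc_innerPart_iff (hbs : b ∈ s)
    {x y : α} (hmx : m < x) (hxb : x < b) :
    IsCyclicSucc (innerPart s m b) x y ↔ IsCyclicSucc s x y := by
  simp only [IsCyclicSucc, mem_innerPart]
  constructor
  · rintro ⟨⟨h1, h2⟩, h | h⟩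
    · refine ⟨h1, Or.inl ⟨h.1, fun z hz hz' => ?_⟩⟩
      rcases le_or_gt z b with hzb | hzb
      · exact h.2 z ⟨hz, by grind, hzb⟩ hz'
      · grind
    · exact absurd (h.1 b ⟨hbs, by grind, le_rfl⟩) (by grind)
  · rintro ⟨h1, h | h⟩
    · exact ⟨⟨h1, by grind, h.2 b hbs hxb⟩, Or.inl ⟨h.1, fun z hz hz' => h.2 z hz.1 hz'⟩⟩
    · exact absurd (h.1 b hbs) (by grind)

/-- Composing the cycle on `s` with the transposition of `min s` and `b` cuts it into the cycles on
`outerPart s (min s) b` and `innerPart s (min s) b`. -/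
theorem isCyclicSucc_mul_swap_iff (hms : m ∈ s) (hm : ∀ x ∈ s, m ≤ x) (hbs : b ∈ s) (hmb : m < b)
    (π : Equiv.Perm α) :
    (∀ x ∈ s, IsCyclicSucc s x ((π * Equiv.swap m b) x)) ↔
      (∀ x ∈ outerPart s m b, IsCyclicSucc (outerPart s m b) x (π x)) ∧
      (∀ x ∈ innerPart s m b, IsCyclicSucc (innerPart s m b) x (π x)) := by
  have hmv : (π * Equiv.swap m b) m = π b := by simp
  have hbv : (π * Equiv.swap m b) b = π m := by simp
  have hv : ∀ x, x ≠ m → x ≠ b → (π * Equiv.swap m b) x = π x := fun x h1 h2 => by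
    simp [Equiv.swap_apply_of_ne_of_ne h1 h2]
  generalize (π * Equiv.swap m b) = σ at *
  constructor
  · refine fun h => ⟨fun x hx => ?_, fun x hx => ?_⟩
    · rcases (mem_outerPart.1 hx).2 with rfl | hbx
      · rw [isCyclicSucc_outerPart_min_iff hms hm hmb, ← hbv]
        exact h b hbs
      · rw [isCyclicSucc_outerPart_iff hms hm hbx, ← hv x (hmb.trans hbx).ne' hbx.ne']
        exact h x (mem_outerPart.1 hx).1
    · obtain ⟨hxs, hmx, hxb⟩ := mem_innerPart.1 hx
      rcases hxb.eq_or_lt with rfl | hxb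
      · rw [isCyclicSucc_innerPart_max_iff hbs hmb, ← hmv]
        exact h m hms
      · rw [isCyclicSucc_innerPart_iff hbs hmx hxb, ← hv x hmx.ne' hxb.ne]
        exact h x hxs
  · rintro ⟨h1, h2⟩ x hx
    rcases (hm x hx).eq_or_lt with rfl | hmx
    · rw [hmv, ← isCyclicSucc_innerPart_max_iff hbs hmb]
      exact h2 b (mem_innerPart.2 ⟨hbs, hmb, le_rfl⟩)
    · rcases lt_trichotomy x b with hxb | rfl | hbx
      · rw [hv x hmx.ne' hxb.ne, ← isCyclicSucc_innerPart_iff hbs hmx hxb]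
        exact h2 x (mem_innerPart.2 ⟨hx, hmx, hxb.le⟩)
      · rw [hbv, ← isCyclicSucc_outerPart_min_iff hms hm hmb]
        exact h1 m (mem_outerPart.2 ⟨hms, Or.inl rfl⟩)
      · rw [hv x hmx.ne' hbx.ne', ← isCyclicSucc_outerPart_iff hms hm hbx]
        exact h1 x (mem_outerPart.2 ⟨hx, Or.inr hbx⟩)

end split

end cycles

/-! ### Decomposition at the first transposition -/

section decomposition

variable {α : Type*} [LinearOrder α] {s : Finset α} {m b : α}

theorem eq_filter_append_filter_of_pairwise {l : List (α × α)}
    (hl : l.Pairwise (fun p q => p.1 ≤ q.1)) (c : α) :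
    l = l.filter (fun p => p.1 ≤ c) ++ l.filter (fun p => c < p.1) := by
  induction l with
  | nil => rfl
  | cons p l ih =>
    rw [List.pairwise_cons] at hl
    by_cases h : p.1 ≤ c
    · rw [List.filter_cons_of_pos (by simpa using h), List.filter_cons_of_neg (by simpa using h),
        List.cons_append, ← ih hl.2]
    · have h' : ∀ q ∈ p :: l, c < q.1 := by
        intro q hq
        rcases List.mem_cons.1 hq with rfl | hq
        · exact lt_of_not_ge h
        · exact (lt_of_not_ge h).trans_le (hl.1 q hq)
      rw [List.filter_eq_nil_iff.2 (fun q hq => by simpa using h' q hq),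
        List.filter_eq_self.2 (fun q hq => by simpa using h' q hq), List.nil_append]

/-- A nontrivial increasing factorisation starts with a transposition that moves `min s`. -/
theorem IsIncFact.exists_eq_cons {l : List (α × α)} (h : IsIncFact s l) (hms : m ∈ s)
    (hm : ∀ x ∈ s, m ≤ x) (hs : 2 ≤ s.card) :
    ∃ b l', l = (m, b) :: l' := by
  obtain ⟨p, l', rfl⟩ : ∃ p l', l = p :: l' := by
    rcases l with _ | ⟨p, l'⟩
    · have := h.length
      simp only [List.length_nil] at this
      omega
    · exact ⟨p, l', rfl⟩
  suffices hp : p.1 = m from ⟨p.2, l', by rw [← hp]⟩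
  by_contra hp
  have hlt : ∀ q ∈ p :: l', m < q.1 := by
    have h1 : m < p.1 := lt_of_le_of_ne (hm _ (h.left_mem p List.mem_cons_self)) (Ne.symm hp)
    intro q hq
    rcases List.mem_cons.1 hq with rfl | hq
    · exact h1
    · exact h1.trans_le ((List.pairwise_cons.1 h.sorted).1 q hq)
  have hfix : swapProd (p :: l') m = m := swapProd_apply_of_forall_ne fun q hq =>
    ⟨(hlt q hq).ne, ((hlt q hq).trans (h.lt q hq)).ne⟩
  have hsucc := h.succ m hms
  rw [hfix] at hsucc
  obtain ⟨-, h1 | h1⟩ := hsucc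
  · exact lt_irrefl _ h1.1
  · obtain ⟨x, hx, y, hy, hxy⟩ := Finset.one_lt_card.1 hs
    exact hxy ((le_antisymm (h1.1 x hx) (hm x hx)).trans (le_antisymm (hm y hy) (h1.1 y hy)))

/-- The transpositions of the factorisation that remain when the first one, `(m b)`, is removed
split into increasing factorisations of the two cycles that `(m b)` cuts off. -/
theorem IsIncFact.split [Finite α] {l : List (α × α)} (h : IsIncFact s ((m, b) :: l))
    (hm : ∀ x ∈ s, m ≤ x) :
    (∀ p ∈ l, p.1 ∈ outerPart s m b ↔ p.2 ∈ outerPart s m b) ∧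
    IsIncFact (outerPart s m b) (l.filter (fun p => p.1 ∈ outerPart s m b)) ∧
    IsIncFact (innerPart s m b) (l.filter (fun p => p.1 ∈ innerPart s m b)) := by
  have hmb : m < b := h.lt _ List.mem_cons_self
  have hms : m ∈ s := h.left_mem _ List.mem_cons_self
  have hbs : b ∈ s := h.right_mem _ List.mem_cons_self
  have hlt : ∀ p ∈ l, p.1 < p.2 := fun p hp => h.lt p (List.mem_cons_of_mem _ hp)
  have hleft : ∀ p ∈ l, p.1 ∈ s := fun p hp => h.left_mem p (List.mem_cons_of_mem _ hp)
  have hright : ∀ p ∈ l, p.2 ∈ s := fun p hp => h.right_mem p (List.mem_cons_of_mem _ hp)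
  have hlen : l.length + 2 = s.card := h.length
  have hcard := card_outerPart_add_card_innerPart (b := b) hm
  have hmem := fun x => mem_iff_outerPart_or_innerPart (b := b) hm x
  have hdis : Disjoint (outerPart s m b) (innerPart s m b) := disjoint_outerPart_innerPart
  rw [Finset.disjoint_left] at hdis
  obtain ⟨hA, hB⟩ := (isCyclicSucc_mul_swap_iff hms hm hbs hmb (swapProd l)).1 h.succ
  have hlA := mem_iff_mem_of_two_cycles hmem hlen.le hleft hright hA hB
  have hlB : ∀ p ∈ l, p.1 ∈ innerPart s m b ↔ p.2 ∈ innerPart s m b := fun p hp => by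
    have h1 := hlA p hp
    have h2 := (hmem _).1 (hleft p hp)
    have h3 := (hmem _).1 (hright p hp)
    have h4 := @hdis p.1
    have h5 := @hdis p.2
    tauto
  have hA' : ∀ x ∈ outerPart s m b, IsCyclicSucc (outerPart s m b) x
      (swapProd (l.filter (fun p => p.1 ∈ outerPart s m b)) x) := fun x hx => by
    rw [(swapProd_filter_of_mem hlA hx).1]; exact hA x hx
  have hB' : ∀ x ∈ innerPart s m b, IsCyclicSucc (innerPart s m b) x
      (swapProd (l.filter (fun p => p.1 ∈ innerPart s m b)) x) := fun x hx => by
    rw [(swapProd_filter_of_mem hlB hx).1]; exact hB x hx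
  have hcA := card_le_of_forall_isCyclicSucc hA'
  have hcB := card_le_of_forall_isCyclicSucc hB'
  have hsum : (l.filter (fun p => p.1 ∈ outerPart s m b)).length +
      (l.filter (fun p => p.1 ∈ innerPart s m b)).length = l.length := by
    rw [List.length_eq_length_filter_add (l := l) (fun p => decide (p.1 ∈ outerPart s m b))]
    congr 2
    apply List.filter_congr
    intro p hp
    have h2 := (hmem _).1 (hleft p hp)
    have h4 := @hdis p.1
    by_cases hpA : p.1 ∈ outerPart s m b <;> simp_all
  have hsorted := (List.pairwise_cons.1 h.sorted).2
  refine ⟨hlA, ⟨?_, ?_, ?_, ?_, ?_, ?_, hA'⟩, ⟨?_, ?_, ?_, ?_, ?_, ?_, hB'⟩⟩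
  · exact fun p hp => hlt p (List.mem_of_mem_filter hp)
  · exact fun p hp => by simpa using (List.mem_filter.1 hp).2
  · exact fun p hp => (hlA p (List.mem_of_mem_filter hp)).1 (by simpa using (List.mem_filter.1 hp).2)
  · omega
  · exact hsorted.filter _
  · refine fun x hx => swapProd_apply_of_forall_ne fun p hp => ?_
    obtain ⟨hp1, hp2⟩ := List.mem_filter.1 hp
    have hp2 : p.1 ∈ outerPart s m b := by simpa using hp2
    have := (hlA p hp1).1 hp2
    exact ⟨fun h => hx (h ▸ hp2), fun h => hx (h ▸ this)⟩
  · exact fun p hp => hlt p (List.mem_of_mem_filter hp)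
  · exact fun p hp => by simpa using (List.mem_filter.1 hp).2
  · exact fun p hp => (hlB p (List.mem_of_mem_filter hp)).1 (by simpa using (List.mem_filter.1 hp).2)
  · omega
  · exact hsorted.filter _
  · refine fun x hx => swapProd_apply_of_forall_ne fun p hp => ?_
    obtain ⟨hp1, hp2⟩ := List.mem_filter.1 hp
    have hp2 : p.1 ∈ innerPart s m b := by simpa using hp2
    have := (hlB p hp1).1 hp2
    exact ⟨fun h => hx (h ▸ hp2), fun h => hx (h ▸ this)⟩

/-- The sorted shuffle of a factorisation `lA` of the cycle on `outerPart s m b` and a factorisation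
`lB` of the cycle on `innerPart s m b`: first entries in `innerPart s m b` come after `m` and before
all the other elements of `outerPart s m b`. -/
def shuffle (m : α) (lA lB : List (α × α)) : List (α × α) :=
  lA.filter (fun p => p.1 = m) ++ (lB ++ lA.filter (fun p => p.1 ≠ m))

theorem mem_shuffle {lA lB : List (α × α)} {p : α × α} :
    p ∈ shuffle m lA lB ↔ p ∈ lA ∨ p ∈ lB := by
  simp only [shuffle, List.mem_append, List.mem_filter, decide_eq_true_eq]
  tauto

theorem length_shuffle {lA lB : List (α × α)} :
    (shuffle m lA lB).length = lA.length + lB.length := by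
  have h := List.length_eq_length_filter_add (l := lA) (fun p => decide (p.1 = m))
  have h2 : lA.filter (fun p => p.1 ≠ m) = lA.filter (fun p => !decide (p.1 = m)) :=
    List.filter_congr (by simp)
  simp only [shuffle, List.length_append, h2]
  omega

theorem filter_append_filter_eq_self {lA : List (α × α)}
    (hA : lA.Pairwise (fun p q => p.1 ≤ q.1)) (hm : ∀ p ∈ lA, m ≤ p.1) :
    lA.filter (fun p => p.1 = m) ++ lA.filter (fun p => p.1 ≠ m) = lA := by
  conv_rhs => rw [eq_filter_append_filter_of_pairwise hA m]
  congr 1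
  · apply List.filter_congr
    intro p hp
    have := hm p hp
    simp only [decide_eq_decide]
    exact ⟨fun h => h.le, fun h => le_antisymm h this⟩
  · apply List.filter_congr
    intro p hp
    have := hm p hp
    simp only [decide_eq_decide]
    exact ⟨fun h => lt_of_le_of_ne this (Ne.symm h), fun h => h.ne'⟩

theorem filter_outerPart_shuffle {lA lB : List (α × α)} (hm : ∀ x ∈ s, m ≤ x)
    (hA : IsIncFact (outerPart s m b) lA) (hB : IsIncFact (innerPart s m b) lB) :
    (shuffle m lA lB).filter (fun p => p.1 ∈ outerPart s m b) = lA := by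
  have h1 : lB.filter (fun p => p.1 ∈ outerPart s m b) = [] := by
    rw [List.filter_eq_nil_iff]
    intro p hp
    simpa using Finset.disjoint_right.1 disjoint_outerPart_innerPart (hB.left_mem p hp)
  have h2 : ∀ p ∈ lA, p.1 ∈ outerPart s m b := hA.left_mem
  have h3 : ∀ q : α × α → Bool,
      (lA.filter q).filter (fun p => p.1 ∈ outerPart s m b) = lA.filter q := fun q =>
    List.filter_eq_self.2 fun p hp => by simpa using h2 p (List.mem_of_mem_filter hp)
  rw [shuffle, List.filter_append, List.filter_append, h1, List.nil_append, h3, h3]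
  exact filter_append_filter_eq_self hA.sorted fun p hp => hm _ (mem_outerPart.1 (h2 p hp)).1

theorem filter_innerPart_shuffle {lA lB : List (α × α)}
    (hA : IsIncFact (outerPart s m b) lA) (hB : IsIncFact (innerPart s m b) lB) :
    (shuffle m lA lB).filter (fun p => p.1 ∈ innerPart s m b) = lB := by
  have h2 : ∀ p ∈ lA, p.1 ∉ innerPart s m b := fun p hp =>
    Finset.disjoint_left.1 disjoint_outerPart_innerPart (hA.left_mem p hp)
  rw [shuffle, List.filter_append, List.filter_append, List.filter_eq_nil_iff.2,
    List.nil_append, List.filter_eq_self.2, List.filter_eq_nil_iff.2, List.append_nil]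
  · exact fun p hp => by simpa using h2 p (List.mem_of_mem_filter hp)
  · exact fun p hp => by simpa using hB.left_mem p hp
  · exact fun p hp => by simpa using h2 p (List.mem_of_mem_filter hp)

/-- A list sorted by first entries is the shuffle of its two parts. -/
theorem shuffle_filter_filter {l : List (α × α)} (hl : l.Pairwise (fun p q => p.1 ≤ q.1))
    (hm : ∀ x ∈ s, m ≤ x) (hmb : m < b) (hls : ∀ p ∈ l, p.1 ∈ s) :
    shuffle m (l.filter (fun p => p.1 ∈ outerPart s m b))
      (l.filter (fun p => p.1 ∈ innerPart s m b)) = l := by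
  conv_rhs => rw [eq_filter_append_filter_of_pairwise hl m,
    eq_filter_append_filter_of_pairwise (hl.filter (fun p => m < p.1)) b]
  simp only [shuffle, List.filter_filter]
  congr 1
  · apply List.filter_congr
    intro p hp
    have := hm _ (hls p hp)
    have := hls p hp
    rw [← Bool.decide_and, decide_eq_decide, mem_outerPart]
    grind
  · congr 1 <;> apply List.filter_congr <;> intro p hp
    · have := hls p hp
      rw [← Bool.decide_and, decide_eq_decide, mem_innerPart]
      grind
    · have := hls p hp
      rw [← Bool.decide_and, ← Bool.decide_and, decide_eq_decide, mem_outerPart]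
      grind

/-- Increasing factorisations of the cycles on `outerPart s m b` and `innerPart s m b` combine to
one of the cycle on `s` that starts with the transposition of `m = min s` and `b`. -/
theorem IsIncFact.cons_shuffle {lA lB : List (α × α)} (hms : m ∈ s) (hm : ∀ x ∈ s, m ≤ x)
    (hbs : b ∈ s) (hmb : m < b)
    (hA : IsIncFact (outerPart s m b) lA) (hB : IsIncFact (innerPart s m b) lB) :
    IsIncFact s ((m, b) :: shuffle m lA lB) := by
  have hmem := fun x => mem_iff_outerPart_or_innerPart (b := b) hm x
  have hdis : Disjoint (outerPart s m b) (innerPart s m b) := disjoint_outerPart_innerPart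
  have hleft : ∀ p ∈ shuffle m lA lB, p.1 ∈ s := by
    intro p hp
    rw [hmem]
    exact (mem_shuffle.1 hp).imp (hA.left_mem p) (hB.left_mem p)
  have hright : ∀ p ∈ shuffle m lA lB, p.2 ∈ s := by
    intro p hp
    rw [hmem]
    exact (mem_shuffle.1 hp).imp (hA.right_mem p) (hB.right_mem p)
  have hlA : ∀ p ∈ shuffle m lA lB, p.1 ∈ outerPart s m b ↔ p.2 ∈ outerPart s m b := by
    intro p hp
    rcases mem_shuffle.1 hp with hp | hp
    · exact iff_of_true (hA.left_mem p hp) (hA.right_mem p hp)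
    · exact iff_of_false (Finset.disjoint_right.1 hdis (hB.left_mem p hp))
        (Finset.disjoint_right.1 hdis (hB.right_mem p hp))
  have hlB : ∀ p ∈ shuffle m lA lB, p.1 ∈ innerPart s m b ↔ p.2 ∈ innerPart s m b := by
    intro p hp
    rcases mem_shuffle.1 hp with hp | hp
    · exact iff_of_false (Finset.disjoint_left.1 hdis (hA.left_mem p hp))
        (Finset.disjoint_left.1 hdis (hA.right_mem p hp))
    · exact iff_of_true (hB.left_mem p hp) (hB.right_mem p hp)
  refine ⟨?_, ?_, ?_, ?_, ?_, ?_, ?_⟩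
  · intro p hp
    rcases List.mem_cons.1 hp with rfl | hp
    · exact hmb
    · exact (mem_shuffle.1 hp).elim (hA.lt p) (hB.lt p)
  · intro p hp
    rcases List.mem_cons.1 hp with rfl | hp
    · exact hms
    · exact hleft p hp
  · intro p hp
    rcases List.mem_cons.1 hp with rfl | hp
    · exact hbs
    · exact hright p hp
  · have h1 := card_outerPart_add_card_innerPart (b := b) hm
    have h2 := hA.length
    have h3 := hB.length
    rw [List.length_cons, length_shuffle]
    omega
  · rw [List.pairwise_cons]
    refine ⟨fun p hp => hm _ (hleft p hp), ?_⟩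
    have hA1 : ∀ p ∈ lA, p.1 ≠ m → b < p.1 := fun p hp h =>
      (mem_outerPart.1 (hA.left_mem p hp)).2.resolve_left h
    have hB1 : ∀ p ∈ lB, p.1 ≤ b := fun p hp => (mem_innerPart.1 (hB.left_mem p hp)).2.2
    rw [shuffle, List.pairwise_append, List.pairwise_append]
    refine ⟨hA.sorted.filter _, ⟨hB.sorted, hA.sorted.filter _, ?_⟩, ?_⟩
    · intro p hp q hq
      obtain ⟨hq1, hq2⟩ := List.mem_filter.1 hq
      exact (hB1 p hp).trans (hA1 q hq1 (by simpa using hq2)).le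
    · intro p hp q hq
      obtain ⟨hp1, hp2⟩ := List.mem_filter.1 hp
      have hp2 : p.1 = m := by simpa using hp2
      rw [hp2]
      rcases List.mem_append.1 hq with hq | hq
      · exact hm _ (hleft q (mem_shuffle.2 (Or.inr hq)))
      · exact hm _ (hleft q (mem_shuffle.2 (Or.inl (List.mem_of_mem_filter hq))))
  · intro x hx
    refine swapProd_apply_of_forall_ne fun p hp => ?_
    rcases List.mem_cons.1 hp with rfl | hp
    · exact ⟨fun h => hx (h ▸ hms), fun h => hx (h ▸ hbs)⟩
    · exact ⟨fun h => hx (h ▸ hleft p hp), fun h => hx (h ▸ hright p hp)⟩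
  · rw [show swapProd ((m, b) :: shuffle m lA lB) =
      swapProd (shuffle m lA lB) * Equiv.swap m b from rfl,
      isCyclicSucc_mul_swap_iff hms hm hbs hmb]
    refine ⟨fun x hx => ?_, fun x hx => ?_⟩
    · rw [← (swapProd_filter_of_mem hlA hx).1, filter_outerPart_shuffle hm hA hB]
      exact hA.succ x hx
    · rw [← (swapProd_filter_of_mem hlB hx).1, filter_innerPart_shuffle hA hB]
      exact hB.succ x hx

end decomposition

/-! ### Left ends and right ends -/

section ends

variable {α : Type*} [LinearOrder α] {s : Finset α} {m b : α}

theorem mem_lefts {l : List (α × α)} {x : α} : x ∈ lefts l ↔ ∃ p ∈ l, p.1 = x := by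
  simp [lefts]

theorem mem_rights {l : List (α × α)} {x : α} : x ∈ rights l ↔ ∃ p ∈ l, p.2 = x := by
  simp [rights]

theorem lefts_cons_shuffle {lA lB : List (α × α)} :
    lefts ((m, b) :: shuffle m lA lB) = insert m (lefts lA ∪ lefts lB) := by
  ext x
  simp only [mem_lefts, Finset.mem_insert, Finset.mem_union, List.mem_cons, mem_shuffle]
  constructor
  · rintro ⟨p, rfl | h | h, rfl⟩ <;> grind
  · rintro (rfl | ⟨p, h, rfl⟩ | ⟨p, h, rfl⟩)
    · exact ⟨_, Or.inl rfl, rfl⟩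
    · exact ⟨p, Or.inr (Or.inl h), rfl⟩
    · exact ⟨p, Or.inr (Or.inr h), rfl⟩

theorem rights_cons_shuffle {lA lB : List (α × α)} :
    rights ((m, b) :: shuffle m lA lB) = insert b (rights lA ∪ rights lB) := by
  ext x
  simp only [mem_rights, Finset.mem_insert, Finset.mem_union, List.mem_cons, mem_shuffle]
  constructor
  · rintro ⟨p, rfl | h | h, rfl⟩ <;> grind
  · rintro (rfl | ⟨p, h, rfl⟩ | ⟨p, h, rfl⟩)
    · exact ⟨_, Or.inl rfl, rfl⟩
    · exact ⟨p, Or.inr (Or.inl h), rfl⟩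
    · exact ⟨p, Or.inr (Or.inr h), rfl⟩

theorem IsIncFact.lefts_subset {l : List (α × α)} (h : IsIncFact s l) : lefts l ⊆ s := by
  intro x hx
  obtain ⟨p, hp, rfl⟩ := mem_lefts.1 hx
  exact h.left_mem p hp

theorem IsIncFact.rights_subset {l : List (α × α)} (h : IsIncFact s l) : rights l ⊆ s := by
  intro x hx
  obtain ⟨p, hp, rfl⟩ := mem_rights.1 hx
  exact h.right_mem p hp

theorem IsIncFact.eq_nil {l : List (α × α)} (h : IsIncFact s l) (hs : s.card ≤ 1) : l = [] := by
  have := h.length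
  exact List.length_eq_zero_iff.1 (by omega)

theorem isIncFact_nil (hs : s.card = 1) : IsIncFact s [] := by
  obtain ⟨a, rfl⟩ := Finset.card_eq_one.1 hs
  refine ⟨by simp, by simp, by simp, by simp, by simp, by simp [swapProd], ?_⟩
  simp [swapProd, IsCyclicSucc]

theorem IsIncFact.min_mem_lefts {l : List (α × α)} (h : IsIncFact s l) (hms : m ∈ s)
    (hm : ∀ x ∈ s, m ≤ x) (hs : 2 ≤ s.card) : m ∈ lefts l := by
  obtain ⟨b, l, rfl⟩ := h.exists_eq_cons hms hm hs
  exact mem_lefts.2 ⟨_, List.mem_cons_self, rfl⟩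

theorem IsIncFact.lt_of_mem_rights {l : List (α × α)} (h : IsIncFact s l) (hm : ∀ x ∈ s, m ≤ x)
    {x : α} (hx : x ∈ rights l) : m < x := by
  obtain ⟨p, hp, rfl⟩ := mem_rights.1 hx
  exact (hm _ (h.left_mem p hp)).trans_lt (h.lt p hp)

theorem IsIncFact.lt_of_mem_lefts {l : List (α × α)} (h : IsIncFact s l) (hb : ∀ x ∈ s, x ≤ b)
    {x : α} (hx : x ∈ lefts l) : x < b := by
  obtain ⟨p, hp, rfl⟩ := mem_lefts.1 hx
  exact (h.lt p hp).trans_le (hb _ (h.right_mem p hp))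

/-- A nontrivial increasing factorisation is a transposition `(m b)` followed
by a shuffle. -/
theorem IsIncFact.exists_shuffle [Finite α] {l : List (α × α)} (h : IsIncFact s l) (hms : m ∈ s)
    (hm : ∀ x ∈ s, m ≤ x) (hs : 2 ≤ s.card) :
    ∃ b lA lB, b ∈ s ∧ m < b ∧ IsIncFact (outerPart s m b) lA ∧ IsIncFact (innerPart s m b) lB ∧
      l = (m, b) :: shuffle m lA lB := by
  obtain ⟨b, l, rfl⟩ := h.exists_eq_cons hms hm hs
  obtain ⟨-, hA, hB⟩ := h.split hm
  have hmb : m < b := h.lt _ List.mem_cons_self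
  refine ⟨b, _, _, h.right_mem _ List.mem_cons_self, hmb, hA, hB, ?_⟩
  rw [shuffle_filter_filter (List.pairwise_cons.1 h.sorted).2 hm hmb
    fun p hp => h.left_mem p (List.mem_cons_of_mem _ hp)]

/-- The left ends and the right ends of an increasing factorisation are disjoint, and cover
everything except possibly the minimum, which they miss only for the trivial cycle. -/
theorem IsIncFact.disjoint_and_cover [Finite α] {l : List (α × α)} (h : IsIncFact s l) :
    Disjoint (lefts l) (rights l) ∧
      ∀ x ∈ s, (∃ y ∈ s, y < x) → x ∈ lefts l ∨ x ∈ rights l := by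
  induction hn : s.card using Nat.strong_induction_on generalizing s l with
  | _ n ih =>
  rcases le_or_gt s.card 1 with hs | hs
  · rw [h.eq_nil hs]
    refine ⟨by simp [lefts], fun x hx ⟨y, hy, hyx⟩ => ?_⟩
    exact absurd (Finset.card_le_one.1 hs x hx y hy) hyx.ne'
  · have hne : s.Nonempty := Finset.card_pos.1 (by omega)
    have hms := s.min'_mem hne
    have hm : ∀ x ∈ s, s.min' hne ≤ x := fun x hx => s.min'_le x hx
    generalize s.min' hne = m at hms hm
    obtain ⟨b, lA, lB, hbs, hmb, hA, hB, rfl⟩ := h.exists_shuffle hms hm hs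
    have hcard := card_outerPart_add_card_innerPart (b := b) hm
    have hmA : m ∈ outerPart s m b := mem_outerPart.2 ⟨hms, Or.inl rfl⟩
    have hbB : b ∈ innerPart s m b := mem_innerPart.2 ⟨hbs, hmb, le_rfl⟩
    have hApos := Finset.card_pos.2 ⟨m, hmA⟩
    have hBpos := Finset.card_pos.2 ⟨b, hbB⟩
    obtain ⟨dA, cA⟩ := ih _ (by omega) hA rfl
    obtain ⟨dB, cB⟩ := ih _ (by omega) hB rfl
    have hdis := Finset.disjoint_left.1 (disjoint_outerPart_innerPart (s := s) (m := m) (b := b))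
    rw [lefts_cons_shuffle, rights_cons_shuffle]
    constructor
    · rw [Finset.disjoint_left] at dA dB ⊢
      intro x hx hx'
      rw [Finset.mem_insert, Finset.mem_union] at hx hx'
      rcases hx with rfl | hx | hx
      · rcases hx' with rfl | hx' | hx'
        · exact lt_irrefl _ hmb
        · exact lt_irrefl _ (hA.lt_of_mem_rights (fun z hz => hm z (mem_outerPart.1 hz).1) hx')
        · exact lt_irrefl _ (hB.lt_of_mem_rights (fun z hz => hm z (mem_innerPart.1 hz).1) hx')
      · rcases hx' with rfl | hx' | hx'
        · exact hdis (hA.lefts_subset hx) hbB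
        · exact dA hx hx'
        · exact hdis (hA.lefts_subset hx) (hB.rights_subset hx')
      · rcases hx' with rfl | hx' | hx'
        · exact lt_irrefl _ (hB.lt_of_mem_lefts (fun z hz => (mem_innerPart.1 hz).2.2) hx)
        · exact hdis (hA.rights_subset hx') (hB.lefts_subset hx)
        · exact dB hx hx'
    · rintro x hx ⟨y, hy, hyx⟩
      simp only [Finset.mem_insert, Finset.mem_union]
      rcases (mem_iff_outerPart_or_innerPart (b := b) hm x).1 hx with hxA | hxB
      · have := cA x hxA ⟨m, hmA, (hm y hy).trans_lt hyx⟩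
        tauto
      · by_cases hlow : ∃ z ∈ innerPart s m b, z < x
        · have := cB x hxB hlow
          tauto
        · push Not at hlow
          -- `x` is the minimum of the inner part
          rcases eq_or_ne x b with rfl | hxb
          · tauto
          · have := hB.min_mem_lefts hxB hlow (Finset.one_lt_card.2 ⟨x, hxB, b, hbB, hxb⟩)
            tauto

theorem IsIncFact.lefts_union_rights [Finite α] {l : List (α × α)} (h : IsIncFact s l)
    (hs : 2 ≤ s.card) : lefts l ∪ rights l = s := by
  refine (Finset.union_subset h.lefts_subset h.rights_subset).antisymm fun x hx => ?_
  rw [Finset.mem_union]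
  by_cases hlow : ∃ y ∈ s, y < x
  · exact h.disjoint_and_cover.2 x hx hlow
  · push Not at hlow
    exact Or.inl (h.min_mem_lefts hx hlow hs)

/-- The number of left ends of a shuffle: `m` is already a left end of a nonempty `lA`. -/
theorem card_lefts_cons_shuffle {lA lB : List (α × α)} (hms : m ∈ s) (hm : ∀ x ∈ s, m ≤ x)
    (hA : IsIncFact (outerPart s m b) lA)
    (hB : IsIncFact (innerPart s m b) lB) :
    (lefts ((m, b) :: shuffle m lA lB)).card =
      (if (outerPart s m b).card = 1 then 1 else (lefts lA).card) + (lefts lB).card := by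
  have hmA : m ∈ outerPart s m b := mem_outerPart.2 ⟨hms, Or.inl rfl⟩
  have hdis := Finset.disjoint_left.1 (disjoint_outerPart_innerPart (s := s) (m := m) (b := b))
  rw [lefts_cons_shuffle]
  split_ifs with h1
  · rw [hA.eq_nil h1.le]
    have : lefts ([] : List (α × α)) = ∅ := rfl
    rw [this, Finset.empty_union, Finset.card_insert_of_notMem, add_comm]
    exact fun h => hdis hmA (hB.lefts_subset h)
  · have hpos := Finset.card_pos.2 ⟨m, hmA⟩
    rw [Finset.insert_eq_of_mem, Finset.card_union_of_disjoint]
    · rw [Finset.disjoint_left]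
      exact fun x hx hx' => hdis (hA.lefts_subset hx) (hB.lefts_subset hx')
    · exact Finset.mem_union_left _ (hA.min_mem_lefts hmA (fun z hz => hm z (mem_outerPart.1 hz).1)
        (by omega))

end ends

/-! ### Narayana polynomials -/

section narayana

/-- A homogeneous first-order linear differential equation over power series with leading
coefficient a unit has no nonzero solution that vanishes at `0`. -/
theorem PowerSeries.eq_zero_of_mul_derivative_eq {R : Type*} [CommRing R] [IsDomain R] [CharZero R]
    {D G E : PowerSeries R} (hD : PowerSeries.coeff 0 D = 1) (hE : PowerSeries.coeff 0 E = 0)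
    (h : D * PowerSeries.derivative R E = G * E) : E = 0 := by
  have key : ∀ n, PowerSeries.coeff n E = 0 := by
    intro n
    induction n using Nat.strong_induction_on with
    | _ n ih =>
    rcases n with _ | n
    · exact hE
    · have h1 := congrArg (PowerSeries.coeff n) h
      rw [PowerSeries.coeff_mul, PowerSeries.coeff_mul,
        Finset.sum_eq_single (0, n), Finset.sum_eq_zero, hD, one_mul,
        PowerSeries.coeff_derivative] at h1
      · exact (mul_eq_zero.1 h1).resolve_right (by exact_mod_cast Nat.succ_ne_zero n)
      · intro p hp
        rw [ih _ (by have := Finset.HasAntidiagonal.mem_antidiagonal.1 hp; omega), mul_zero]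
      · intro p hp hne
        have hp := Finset.HasAntidiagonal.mem_antidiagonal.1 hp
        have : p.1 ≠ 0 := fun h0 => hne (Prod.ext h0 (by simp only; omega))
        rw [PowerSeries.coeff_derivative, ih _ (by omega), zero_mul, mul_zero]
      · simp
  ext n
  simpa using key n

open Polynomial

/-- The Narayana number `N(m, k + 1) = C(m, k + 1) C(m, k) / m`. -/
def narayanaCoeff (m k : ℕ) : ℚ := (m.choose (k + 1) : ℚ) * (m.choose k : ℚ) / m

/-- The Narayana polynomial `∑ k, N(n - 1, k) X ^ k`, which will turn out to count the increasing
factorisations of size `n` by their number of left ends; the value at `n = 1` counts the empty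
factorisation, and the value `0` at `n = 0` is a convention. -/
noncomputable def narayana (n : ℕ) : ℚ[X] :=
  if n = 1 then 1 else ∑ k ∈ Finset.range n, C (narayanaCoeff (n - 1) k) * X ^ (k + 1)

theorem narayana_zero : narayana 0 = 0 := by simp [narayana]

theorem narayana_one : narayana 1 = 1 := by simp [narayana]

theorem narayanaCoeff_eq_zero {m k : ℕ} (h : m ≤ k) : narayanaCoeff m k = 0 := by
  simp [narayanaCoeff, Nat.choose_eq_zero_of_lt (Nat.lt_succ_of_le h)]

theorem coeff_narayana_zero (m : ℕ) : (narayana (m + 2)).coeff 0 = 0 := by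
  simp [narayana]

theorem coeff_narayana_succ (m k : ℕ) :
    (narayana (m + 2)).coeff (k + 1) = narayanaCoeff (m + 1) k := by
  rw [narayana, if_neg (by omega), finsetSum_coeff]
  simp only [coeff_C_mul, coeff_X_pow, Nat.add_right_cancel_iff, mul_ite, mul_one, mul_zero,
    Finset.sum_ite_eq, Finset.mem_range]
  split_ifs with h
  · rfl
  · rw [narayanaCoeff_eq_zero (by omega)]

theorem narayana_two : narayana 2 = X := by
  ext k
  rcases k with _ | _ | k
  · simpa using coeff_narayana_zero 0
  · have := coeff_narayana_succ 0 0
    simp_all [narayanaCoeff]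
  · have := coeff_narayana_succ 0 (k + 1)
    rw [narayanaCoeff_eq_zero (by omega)] at this
    simp_all [coeff_X]

theorem cast_choose_succ_right (m k : ℕ) :
    (m.choose (k + 1) : ℚ) = m.choose k * ((m : ℚ) - k) / (k + 1) := by
  rcases le_or_gt k m with h | h
  · rw [eq_div_iff (by positivity)]
    have := Nat.choose_succ_right_eq m k
    rw [← Nat.cast_sub h]
    exact_mod_cast this
  · simp [Nat.choose_eq_zero_of_lt h, Nat.choose_eq_zero_of_lt (h.trans (Nat.lt_succ_self k))]

theorem narayanaCoeff_zero_right (m : ℕ) : narayanaCoeff (m + 1) 0 = 1 := by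
  simp only [narayanaCoeff, zero_add, Nat.choose_one_right, Nat.choose_zero_right, Nat.cast_one,
    mul_one]
  exact div_self (by positivity)

theorem narayanaCoeff_rec_one (m : ℕ) :
    (m + 4 : ℚ) * narayanaCoeff (m + 3) 1 =
      (2 * m + 5) * (narayanaCoeff (m + 2) 1 + narayanaCoeff (m + 2) 0)
      - (m + 1) * (narayanaCoeff (m + 1) 1 - 2 * narayanaCoeff (m + 1) 0) := by
  simp only [narayanaCoeff, cast_choose_succ_right, Nat.choose_zero_right]
  push_cast
  field_simp
  ring

theorem narayanaCoeff_rec (m k : ℕ) :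
    (m + 4 : ℚ) * narayanaCoeff (m + 3) (k + 2) =
      (2 * m + 5) * (narayanaCoeff (m + 2) (k + 2) + narayanaCoeff (m + 2) (k + 1))
      - (m + 1) * (narayanaCoeff (m + 1) (k + 2) - 2 * narayanaCoeff (m + 1) (k + 1)
        + narayanaCoeff (m + 1) k) := by
  have h2 : ∀ j, ((m + 2).choose (j + 1) : ℚ) = (m + 1).choose j + (m + 1).choose (j + 1) :=
    fun j => by exact_mod_cast Nat.choose_succ_succ' (m + 1) j
  have h3 : ∀ j, ((m + 3).choose (j + 1) : ℚ) = (m + 2).choose j + (m + 2).choose (j + 1) :=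
    fun j => by exact_mod_cast Nat.choose_succ_succ' (m + 2) j
  simp only [narayanaCoeff, h3, h2, add_assoc, Nat.reduceAdd]
  simp only [← add_assoc]
  rw [cast_choose_succ_right (m + 1) (k + 2), cast_choose_succ_right (m + 1) (k + 1),
    cast_choose_succ_right (m + 1) k]
  push_cast
  have : (k : ℚ) + 1 ≠ 0 := by positivity
  have : (k : ℚ) + 1 + 1 ≠ 0 := by positivity
  have : (k : ℚ) + 2 + 1 ≠ 0 := by positivity
  have : (m : ℚ) + 1 ≠ 0 := by positivity
  have : (m : ℚ) + 2 ≠ 0 := by positivity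
  have : (m : ℚ) + 3 ≠ 0 := by positivity
  field_simp
  ring

/-- The three-term recurrence of the Narayana polynomials. -/
theorem narayana_rec (m : ℕ) :
    ((m : ℚ[X]) + 3) * narayana (m + 3) = (2 * (m : ℚ[X]) + 3) * ((1 + X) * narayana (m + 2))
      - (m : ℚ[X]) * ((1 - X) ^ 2 * narayana (m + 1)) := by
  rcases m with _ | m
  · have h3 : narayana 3 = X + X ^ 2 := by
      simp [narayana, narayanaCoeff, Finset.sum_range_succ]
    have h2 : narayana 2 = X := narayana_two
    simp only [zero_add, h2, h3, Nat.cast_zero, zero_mul, mul_zero]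
    ring
  have e1 : (1 + X) * narayana (m + 1 + 2) = narayana (m + 3) + X * narayana (m + 3) := by ring
  have e2 : (1 - X) ^ 2 * narayana (m + 1 + 1) =
      narayana (m + 2) - C 2 * (X * narayana (m + 2)) + X * (X * narayana (m + 2)) := by
    rw [map_ofNat]; ring
  have e3 : ((m + 1 : ℕ) : ℚ[X]) + 3 = C ((m : ℚ) + 4) := by
    simp only [map_add, map_natCast, map_ofNat]; push_cast; ring
  have e4 : 2 * ((m + 1 : ℕ) : ℚ[X]) + 3 = C (2 * (m : ℚ) + 5) := by
    simp only [map_add, map_mul, map_natCast, map_ofNat]; push_cast; ring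
  have e5 : ((m + 1 : ℕ) : ℚ[X]) = C ((m : ℚ) + 1) := by
    simp only [map_add, map_natCast, map_one]; push_cast; ring
  rw [e1, e2, e3, e4, e5]
  ext k
  simp only [coeff_sub, coeff_add, coeff_C_mul]
  rcases k with _ | _ | _ | k
  · simp only [coeff_narayana_zero, coeff_X_mul_zero]
    have := coeff_narayana_zero (m + 1)
    have := coeff_narayana_zero (m + 2)
    simp_all
  · simp only [zero_add]
    rw [show (1 : ℕ) = 0 + 1 from rfl]
    simp only [coeff_X_mul, coeff_X_mul_zero]
    rw [coeff_narayana_zero m, coeff_narayana_zero (m + 1), coeff_narayana_succ m,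
      coeff_narayana_succ (m + 1), coeff_narayana_succ (m + 2)]
    simp only [narayanaCoeff_zero_right]
    ring
  · simp only [coeff_X_mul]
    rw [coeff_narayana_succ m, coeff_narayana_succ (m + 1), coeff_narayana_succ (m + 2),
      coeff_narayana_succ m, coeff_narayana_succ (m + 1), coeff_narayana_zero m]
    have := narayanaCoeff_rec_one m
    linear_combination this
  · simp only [coeff_X_mul]
    rw [coeff_narayana_succ m, coeff_narayana_succ (m + 1), coeff_narayana_succ (m + 2),
      coeff_narayana_succ m, coeff_narayana_succ (m + 1), coeff_narayana_succ m]
    have := narayanaCoeff_rec m k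
    linear_combination this

/-- Convolution recurrence of the Narayana polynomials: it says that the generating function `T`
of the Narayana polynomials solves the quadratic equation `T = x + T (T - x + x y)`. -/
theorem narayana_eq_sum_antidiagonal (n : ℕ) (hn : 2 ≤ n) :
    narayana n = ∑ p ∈ Finset.HasAntidiagonal.antidiagonal n,
      (if p.1 = 1 then X else narayana p.1) * narayana p.2 := by
  -- `S ^ 2 = D` is the quadratic equation with the square completed.
  obtain ⟨x, hx⟩ : ∃ x : PowerSeries ℚ[X], x = PowerSeries.X := ⟨_, rfl⟩
  obtain ⟨T, hT⟩ : ∃ T : PowerSeries ℚ[X], T = PowerSeries.mk narayana := ⟨_, rfl⟩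
  obtain ⟨u, hu⟩ : ∃ u : PowerSeries ℚ[X], u = PowerSeries.C (1 + X : ℚ[X]) := ⟨_, rfl⟩
  obtain ⟨v, hv⟩ : ∃ v : PowerSeries ℚ[X], v = PowerSeries.C (1 - X : ℚ[X]) := ⟨_, rfl⟩
  have huv : u + v = 2 := by
    rw [hu, hv, ← map_add, ← map_ofNat PowerSeries.C 2]
    congr 1
    ring
  obtain ⟨S, hS⟩ : ∃ S : PowerSeries ℚ[X], S = T + T - 1 - x * v := ⟨_, rfl⟩
  obtain ⟨D, hD⟩ : ∃ D : PowerSeries ℚ[X], D = 1 - 2 * (u * x) + v ^ 2 * x ^ 2 := ⟨_, rfl⟩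
  obtain ⟨G, hG⟩ : ∃ G : PowerSeries ℚ[X], G = v ^ 2 * x - u := ⟨_, rfl⟩
  have hS0 : PowerSeries.coeff 0 S = -1 := by
    simp [hS, hT, hx, narayana_zero]
  have hS1 : PowerSeries.coeff 1 S = 1 + X := by
    rw [hS, hx, hv, hT]
    simp only [map_sub, map_add, PowerSeries.coeff_mk, narayana_one, PowerSeries.coeff_one,
      PowerSeries.coeff_succ_X_mul, PowerSeries.coeff_zero_C, one_ne_zero, if_false]
    ring
  have hS2 : ∀ k, PowerSeries.coeff (k + 2) S = 2 * narayana (k + 2) := by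
    intro k
    rw [hS, hx, hv, hT]
    simp only [map_sub, map_add, PowerSeries.coeff_mk, PowerSeries.coeff_one,
      PowerSeries.coeff_succ_X_mul, PowerSeries.coeff_C]
    simp
    ring
  have hode : D * PowerSeries.derivative ℚ[X] S = G * S := by
    obtain ⟨q, hq⟩ : ∃ q : ℚ[X], q = 1 + X := ⟨_, rfl⟩
    obtain ⟨r, hr⟩ : ∃ r : ℚ[X], r = (1 - X) ^ 2 := ⟨_, rfl⟩
    have hvr : v ^ 2 = PowerSeries.C r := by rw [hv, hr, map_pow]
    have e1 : D * PowerSeries.derivative ℚ[X] S = PowerSeries.derivative ℚ[X] S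
        - x * (PowerSeries.C (2 * q) * PowerSeries.derivative ℚ[X] S)
        + x * (x * (PowerSeries.C r * PowerSeries.derivative ℚ[X] S)) := by
      rw [hD, hvr, map_mul, hq, ← hu, map_ofNat]; ring
    have e2 : G * S = x * (PowerSeries.C r * S) - PowerSeries.C q * S := by
      rw [hG, hvr, hq, ← hu]; ring
    rw [e1, e2, hx]
    ext1 k
    rcases k with _ | _ | k
    · simp only [map_sub, map_add, PowerSeries.coeff_zero_X_mul, PowerSeries.coeff_C_mul,
        PowerSeries.coeff_derivative, hS0, zero_add, hS1]
      rw [hq]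
      push_cast
      ring
    · simp only [map_sub, map_add, PowerSeries.coeff_zero_X_mul, PowerSeries.coeff_C_mul,
        PowerSeries.coeff_succ_X_mul, PowerSeries.coeff_derivative, hS0, zero_add, hS1]
      rw [hS2 0, narayana_two, hq, hr]
      push_cast
      ring
    · simp only [map_sub, map_add, PowerSeries.coeff_C_mul,
        PowerSeries.coeff_succ_X_mul, PowerSeries.coeff_derivative]
      have hrec := narayana_rec k
      rw [hS2 (k + 1), hS2 k, hq, hr]
      rcases k with _ | k
      · push_cast at hrec ⊢
        linear_combination 2 * hrec
      · rw [hS2 k]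
        push_cast at hrec ⊢
        linear_combination 2 * hrec
  have hDd : PowerSeries.derivative ℚ[X] D = 2 * G := by
    have h2 : (2 : PowerSeries ℚ[X]) = PowerSeries.C 2 := (map_ofNat _ 2).symm
    rw [hD, hG, hx, hu, hv, ← map_pow, h2]
    simp only [map_sub, map_add, Derivation.leibniz, PowerSeries.derivative_C,
      PowerSeries.derivative_X, PowerSeries.derivative_pow, Derivation.map_one_eq_zero,
      smul_eq_mul]
    rw [← h2]
    push_cast
    ring
  have hE : S ^ 2 - D = 0 := by
    refine PowerSeries.eq_zero_of_mul_derivative_eq (D := D) (G := 2 * G) ?_ ?_ ?_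
    · simp [hD, hx]
    · rw [map_sub, PowerSeries.coeff_zero_eq_constantCoeff_apply, map_pow,
        ← PowerSeries.coeff_zero_eq_constantCoeff_apply, hS0]
      simp [hD, hx]
    · rw [map_sub, hDd, PowerSeries.derivative_pow]
      push_cast
      linear_combination 2 * S * hode
  have hquad : 4 * (T - (x + (T - v * x) * T)) = 0 := by
    rw [hS, hD] at hE
    linear_combination -hE + 2 * x * huv
  have h4 : T = x + (T - v * x) * T := by
    rcases mul_eq_zero.1 hquad with h | h
    · have := congrArg (PowerSeries.coeff 0) h
      simp [← map_ofNat (PowerSeries.C (R := ℚ[X]))] at this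
    · exact sub_eq_zero.1 h
  have h5 := congrArg (PowerSeries.coeff n) h4
  rw [map_add, PowerSeries.coeff_mul, hx, PowerSeries.coeff_X, if_neg (by omega), zero_add,
    hT, PowerSeries.coeff_mk] at h5
  rw [h5]
  refine Finset.sum_congr rfl fun p _ => ?_
  rw [PowerSeries.coeff_mk, map_sub, PowerSeries.coeff_mk, hv, PowerSeries.coeff_C_mul,
    PowerSeries.coeff_X]
  split_ifs with h
  · rw [h, narayana_one]; ring
  · ring

end narayana

/-! ### Counting by the number of left ends -/

section counting

open Polynomial

variable {α : Type*} [LinearOrder α] {s : Finset α} {m : α}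

theorem finite_setOf_isIncFact [Finite α] (s : Finset α) : {l | IsIncFact s l}.Finite :=
  (List.finite_length_eq (α × α) (s.card - 1)).subset fun l hl => by
    have := IsIncFact.length hl
    simp only [Set.mem_ofPred_eq]
    omega

/-- The finite set of increasing factorisations of the cycle on `s`. -/
noncomputable def incFacts [Finite α] (s : Finset α) : Finset (List (α × α)) :=
  (finite_setOf_isIncFact s).toFinset

theorem mem_incFacts [Finite α] {l : List (α × α)} : l ∈ incFacts s ↔ IsIncFact s l := by
  simp [incFacts]

/-- The generating polynomial of increasing factorisations by number of left ends. -/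
noncomputable def leftPoly [Finite α] (s : Finset α) : ℚ[X] :=
  ∑ l ∈ incFacts s, X ^ (lefts l).card

theorem incFacts_of_card_eq_one [Finite α] (hs : s.card = 1) : incFacts s = {[]} := by
  ext l
  rw [mem_incFacts, Finset.mem_singleton]
  exact ⟨fun h => h.eq_nil hs.le, fun h => h ▸ isIncFact_nil hs⟩

theorem leftPoly_of_card_eq_one [Finite α] (hs : s.card = 1) : leftPoly s = 1 := by
  simp [leftPoly, incFacts_of_card_eq_one hs, lefts]

/-- Recurrence from the decomposition at the first transposition `(m b)`. If the outer part is
`{m}`, its empty factorisation does not have `m` as a left end, but `(m b)` does: hence the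
factor `X`. -/
theorem leftPoly_eq_sum [Finite α] (hms : m ∈ s) (hm : ∀ x ∈ s, m ≤ x) (hs : 2 ≤ s.card) :
    leftPoly s = ∑ b ∈ s.filter (m < ·),
      (if (outerPart s m b).card = 1 then X else leftPoly (outerPart s m b)) *
        leftPoly (innerPart s m b) := by
  have hw : ∀ b, (if (outerPart s m b).card = 1 then X else leftPoly (outerPart s m b)) =
      ∑ l ∈ incFacts (outerPart s m b),
        (X : ℚ[X]) ^ (if (outerPart s m b).card = 1 then 1 else (lefts l).card) := by
    intro b
    split_ifs with h
    · simp [incFacts_of_card_eq_one h]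
    · rfl
  simp_rw [hw]
  rw [leftPoly]
  simp_rw [leftPoly, Finset.sum_mul_sum, ← Finset.sum_product', ← pow_add]
  rw [Finset.sum_sigma']
  symm
  refine Finset.sum_bij (fun x _ => (m, x.1) :: shuffle m x.2.1 x.2.2) ?_ ?_ ?_ ?_
  · rintro ⟨b, lA, lB⟩ hx
    simp only [Finset.mem_sigma, Finset.mem_filter, Finset.mem_product, mem_incFacts] at hx ⊢
    exact IsIncFact.cons_shuffle hms hm hx.1.1 hx.1.2 hx.2.1 hx.2.2
  · rintro ⟨b, lA, lB⟩ hx ⟨b', lA', lB'⟩ hx' h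
    simp only [Finset.mem_sigma, Finset.mem_filter, Finset.mem_product, mem_incFacts] at hx hx'
    obtain ⟨h1, h2⟩ := List.cons.inj h
    obtain rfl : b = b' := (Prod.mk.inj h1).2
    have hA := filter_outerPart_shuffle hm hx.2.1 hx.2.2
    have hB := filter_innerPart_shuffle hx.2.1 hx.2.2
    simp only at h2 hA hB
    rw [h2] at hA hB
    rw [filter_outerPart_shuffle hm hx'.2.1 hx'.2.2] at hA
    rw [filter_innerPart_shuffle hx'.2.1 hx'.2.2] at hB
    rw [hA, hB]
  · intro l hl
    obtain ⟨b, lA, lB, hbs, hmb, hA, hB, rfl⟩ := (mem_incFacts.1 hl).exists_shuffle hms hm hs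
    refine ⟨⟨b, lA, lB⟩, ?_, rfl⟩
    simp only [Finset.mem_sigma, Finset.mem_filter, Finset.mem_product, mem_incFacts]
    exact ⟨⟨hbs, hmb⟩, hA, hB⟩
  · rintro ⟨b, lA, lB⟩ hx
    simp only [Finset.mem_sigma, Finset.mem_filter, Finset.mem_product, mem_incFacts] at hx
    rw [card_lefts_cons_shuffle hms hm hx.2.1 hx.2.2]

/-- Summing over the elements of a finite set amounts to summing over their ranks. -/
theorem sum_card_filter_le {M : Type*} [AddCommMonoid M] (t : Finset α) (g : ℕ → M) :
    ∑ b ∈ t, g (t.filter (· ≤ b)).card = ∑ j ∈ Finset.range t.card, g (j + 1) := by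
  induction t using Finset.induction_on_max with
  | empty => simp
  | insert a t ha ih =>
    have hat : a ∉ t := fun h => lt_irrefl _ (ha a h)
    rw [Finset.sum_insert hat, Finset.card_insert_of_notMem hat, Finset.sum_range_succ, ← ih,
      add_comm]
    congr 1
    · refine Finset.sum_congr rfl fun b hb => ?_
      rw [Finset.filter_insert, if_neg (not_le.2 (ha b hb))]
    · rw [Finset.filter_true_of_mem, Finset.card_insert_of_notMem hat]
      intro x hx
      rcases Finset.mem_insert.1 hx with rfl | hx
      · exact le_rfl
      · exact (ha x hx).le

/-- Increasing factorisations are counted by the Narayana numbers. -/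
theorem leftPoly_eq_narayana [Finite α] (hs : s.Nonempty) : leftPoly s = narayana s.card := by
  induction hn : s.card using Nat.strong_induction_on generalizing s with
  | _ n ih =>
  have hpos := Finset.card_pos.2 hs
  rcases (Nat.succ_le_iff.2 hpos).lt_or_eq with h2 | h1
  swap
  · rw [leftPoly_of_card_eq_one h1.symm, ← hn, ← h1, narayana_one]
  have hms := s.min'_mem hs
  have hm : ∀ x ∈ s, s.min' hs ≤ x := fun x hx => s.min'_le x hx
  generalize s.min' hs = m at hms hm
  have hcount : (s.filter (m < ·)).card = n - 1 := by
    have : s.filter (m < ·) = s.erase m := by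
      ext x
      simp only [Finset.mem_filter, Finset.mem_erase]
      constructor
      · exact fun h => ⟨h.2.ne', h.1⟩
      · exact fun h => ⟨h.2, lt_of_le_of_ne (hm x h.2) (Ne.symm h.1)⟩
    rw [this, Finset.card_erase_of_mem hms, hn]
  have hinner : ∀ b, (innerPart s m b).card = ((s.filter (m < ·)).filter (· ≤ b)).card := by
    intro b
    rw [innerPart, Finset.filter_filter]
  let g : ℕ → ℚ[X] := fun j => (if n - j = 1 then X else narayana (n - j)) * narayana j
  rw [leftPoly_eq_sum hms hm h2, Finset.sum_congr (g := fun b =>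
    g ((s.filter (m < ·)).filter (· ≤ b)).card) rfl, sum_card_filter_le, hcount,
    narayana_eq_sum_antidiagonal n (by omega), ← Finset.Nat.sum_antidiagonal_swap,
    Finset.Nat.sum_antidiagonal_eq_sum_range_succ_mk]
  · obtain ⟨k, rfl⟩ : ∃ k, n = k + 2 := ⟨n - 2, by omega⟩
    rw [Finset.sum_range_succ', Finset.sum_range_succ]
    simp [g, narayana_zero]
  · intro b hb
    rw [Finset.mem_filter] at hb
    have hcard := card_outerPart_add_card_innerPart (b := b) hm
    have hA : (outerPart s m b).Nonempty := ⟨m, mem_outerPart.2 ⟨hms, Or.inl rfl⟩⟩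
    have hB : (innerPart s m b).Nonempty := ⟨b, mem_innerPart.2 ⟨hb.1, hb.2, le_rfl⟩⟩
    have hA' := Finset.card_pos.2 hA
    have hB' := Finset.card_pos.2 hB
    rw [ih _ (by omega) hA rfl, ih _ (by omega) hB rfl, ← hinner]
    have : (outerPart s m b).card = n - (innerPart s m b).card := by omega
    rw [this]

theorem card_incFacts_filter [Finite α] (hs : s.Nonempty) (k : ℕ) :
    (((incFacts s).filter (fun l => (lefts l).card = k)).card : ℚ) =
      (narayana s.card).coeff k := by
  rw [← leftPoly_eq_narayana hs, leftPoly, finsetSum_coeff]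
  simp_rw [coeff_X_pow]
  rw [Finset.sum_boole]
  congr 2
  ext l
  simp [eq_comm]

theorem card_incFacts [Finite α] (hs : s.Nonempty) :
    ((incFacts s).card : ℚ) = (narayana s.card).eval 1 := by
  rw [← leftPoly_eq_narayana hs, leftPoly, eval_finsetSum]
  simp

/-- The total number of factorisations, by Vandermonde's identity. -/
theorem eval_one_narayana (m : ℕ) :
    (narayana (m + 2)).eval 1 = ((2 * (m + 1)).choose m : ℚ) / (m + 1) := by
  rw [narayana, if_neg (by omega), eval_finsetSum, Finset.sum_range_succ,
    narayanaCoeff_eq_zero (by omega), two_mul, Nat.add_choose_eq,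
    Finset.Nat.sum_antidiagonal_eq_sum_range_succ_mk, Nat.cast_sum, Finset.sum_div]
  simp only [eval_mul, eval_C, eval_pow, eval_X, one_pow, mul_one, add_zero]
  refine Finset.sum_congr rfl fun k hk => ?_
  have hk : k ≤ m := Nat.lt_succ_iff.1 (Finset.mem_range.1 hk)
  rw [show m + 2 - 1 = m + 1 from rfl, narayanaCoeff,
    ← Nat.choose_symm (n := m + 1) (k := k + 1) (by omega), Nat.add_sub_add_right]
  push_cast
  ring

end counting

/-! ### From lists of pairs to sequences of transpositions -/

section transfer

/-- The transposition encoded by a pair. -/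
def pairSwap {α : Type*} [DecidableEq α] (p : α × α) : Equiv.Perm α := Equiv.swap p.1 p.2

theorem pairSwap_inj {α : Type*} [LinearOrder α] {p q : α × α} (hp : p.1 < p.2) (hq : q.1 < q.2)
    (h : pairSwap p = pairSwap q) : p = q := by
  have h1 := congrArg (fun σ : Equiv.Perm α => σ p.1) h
  have h2 := congrArg (fun σ : Equiv.Perm α => σ q.1) h
  simp only [pairSwap, Equiv.swap_apply_left] at h1 h2
  rw [Equiv.swap_apply_def] at h1 h2
  ext <;> grind

theorem swapProd_eq_prod {α : Type*} [LinearOrder α] (l : List (α × α)) :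
    swapProd l = (l.map pairSwap).reverse.prod := by
  induction l with
  | nil => rfl
  | cons p l ih => simp [swapProd, ih, pairSwap]

theorem isCyclicSucc_univ_finRotate {n : ℕ} (x : Fin n) :
    IsCyclicSucc Finset.univ x (finRotate n x) := by
  rcases n with _ | n
  · exact x.elim0
  · refine ⟨Finset.mem_univ _, ?_⟩
    have h : ((finRotate (n + 1) x : Fin (n + 1)) : ℕ) =
        if x = Fin.last n then (0 : ℕ) else (x : ℕ) + 1 :=
      coe_finRotate x
    simp only [Finset.mem_univ, true_imp_iff, Fin.lt_def, Fin.le_def]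
    by_cases hx : x = Fin.last n
    · rw [if_pos hx] at h
      refine Or.inr ⟨fun z => ?_, fun z => by omega⟩
      have := z.2
      rw [hx, Fin.val_last]
      omega
    · rw [if_neg hx] at h
      have := x.2
      rw [Fin.ext_iff, Fin.val_last] at hx
      exact Or.inl ⟨by omega, fun z hz => by omega⟩

/-- The sequence of transpositions encoded by a list of `n - 1` pairs; the value `1` past the end
of the list is never used. -/
def toFactorisation {n : ℕ} (l : List (Fin n × Fin n)) : Fin (n - 1) → Equiv.Perm (Fin n) :=
  fun i => (l.map pairSwap).getD i 1

variable {n : ℕ} {l : List (Fin n × Fin n)}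

theorem IsIncFact.length_fin (h : IsIncFact Finset.univ l) : l.length = n - 1 := by
  have := h.length
  rw [Finset.card_univ, Fintype.card_fin] at this
  omega

theorem toFactorisation_apply (hl : l.length = n - 1) (i : Fin (n - 1)) :
    toFactorisation l i = pairSwap (l[(i : ℕ)]'(by omega)) := by
  have h : (i : ℕ) < (l.map pairSwap).length := by rw [List.length_map]; omega
  rw [toFactorisation, List.getD_eq_getElem _ _ h, List.getElem_map]

theorem ofFn_toFactorisation (hl : l.length = n - 1) :
    List.ofFn (toFactorisation l) = l.map pairSwap := by
  apply List.ext_getElem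
  · simp [hl]
  · intro i h1 h2
    rw [List.getElem_ofFn, toFactorisation_apply hl, List.getElem_map]

theorem injOn_toFactorisation :
    Set.InjOn (toFactorisation (n := n)) {l | IsIncFact Finset.univ l} := by
  intro l hl l' hl' h
  have h1 := hl.length_fin
  have h2 := hl'.length_fin
  refine List.ext_getElem (h1.trans h2.symm) fun i hi hi' => ?_
  have h3 := congrFun h ⟨i, by omega⟩
  rw [toFactorisation_apply h1, toFactorisation_apply h2] at h3
  exact pairSwap_inj (hl.lt _ (List.getElem_mem _)) (hl'.lt _ (List.getElem_mem _)) h3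

theorem image_toFactorisation (hn : 1 ≤ n) :
    toFactorisation '' {l | IsIncFact (Finset.univ : Finset (Fin n)) l} =
      increasingFactorisations n := by
  ext τ
  constructor
  · rintro ⟨l, hl, rfl⟩
    have hl : IsIncFact Finset.univ l := hl
    have hlen := hl.length_fin
    refine ⟨⟨fun i => ?_, ?_⟩, ?_⟩
    · rw [toFactorisation_apply hlen]
      exact ⟨_, _, (hl.lt _ (List.getElem_mem _)).ne, rfl⟩
    · rw [ofFn_toFactorisation hlen, ← swapProd_eq_prod]
      ext1 x
      exact (hl.succ x (Finset.mem_univ _)).unique (isCyclicSucc_univ_finRotate x)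
    · intro i j hij a b a' b' hab hab' hi hj
      rw [toFactorisation_apply hlen] at hi hj
      have hi := pairSwap_inj (q := (a, b)) (hl.lt _ (List.getElem_mem _)) hab hi
      have hj := pairSwap_inj (q := (a', b')) (hl.lt _ (List.getElem_mem _)) hab' hj
      rcases hij.eq_or_lt with rfl | hij
      · exact (congrArg Prod.fst (hi.symm.trans hj)).le
      · have := List.pairwise_iff_getElem.1 hl.sorted i j (by omega) (by omega) hij
        rwa [hi, hj] at this
  · rintro ⟨⟨hswap, hprod⟩, hinc⟩
    have hex : ∀ i, ∃ p : Fin n × Fin n, p.1 < p.2 ∧ τ i = pairSwap p := by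
      intro i
      obtain ⟨a, b, hab, h⟩ := hswap i
      rcases lt_or_gt_of_ne hab with hab | hab
      · exact ⟨(a, b), hab, h⟩
      · exact ⟨(b, a), hab, h.trans (Equiv.swap_comm a b)⟩
    choose p hp hτ using hex
    have hlen : (List.ofFn p).length = n - 1 := List.length_ofFn
    have heq : toFactorisation (List.ofFn p) = τ := by
      ext1 i
      rw [toFactorisation_apply hlen, hτ, List.getElem_ofFn]
    refine ⟨List.ofFn p, ?_, heq⟩
    have hsp : swapProd (List.ofFn p) = finRotate n := by
      rw [swapProd_eq_prod, ← ofFn_toFactorisation hlen, heq, hprod]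
    refine ⟨?_, by simp, by simp, ?_, ?_, by simp, ?_⟩
    · intro q hq
      obtain ⟨i, rfl⟩ := (List.mem_ofFn' _ _).1 hq
      exact hp i
    · rw [hlen, Finset.card_univ, Fintype.card_fin]
      omega
    · rw [List.pairwise_ofFn]
      intro i j hij
      exact hinc i j hij.le _ _ _ _ (hp i) (hp j) (hτ i) (hτ j)
    · intro x _
      rw [hsp]
      exact isCyclicSucc_univ_finRotate x

theorem leftEnds_toFactorisation (hl : IsIncFact Finset.univ l) :
    leftEnds (toFactorisation l) = ↑(lefts l) := by
  have hlen := hl.length_fin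
  ext a
  rw [Finset.mem_coe, mem_lefts]
  constructor
  · rintro ⟨i, b, hab, h⟩
    rw [toFactorisation_apply hlen] at h
    have := pairSwap_inj (q := (a, b)) (hl.lt _ (List.getElem_mem _)) hab h
    exact ⟨_, List.getElem_mem _, congrArg Prod.fst this⟩
  · rintro ⟨p, hp, rfl⟩
    obtain ⟨i, hi, rfl⟩ := List.getElem_of_mem hp
    exact ⟨⟨i, by omega⟩, l[i].2, hl.lt _ hp, toFactorisation_apply hlen _⟩

theorem rightEnds_toFactorisation (hl : IsIncFact Finset.univ l) :
    rightEnds (toFactorisation l) = ↑(rights l) := by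
  have hlen := hl.length_fin
  ext b
  rw [Finset.mem_coe, mem_rights]
  constructor
  · rintro ⟨i, a, hab, h⟩
    rw [toFactorisation_apply hlen] at h
    have := pairSwap_inj (q := (a, b)) (hl.lt _ (List.getElem_mem _)) hab h
    exact ⟨_, List.getElem_mem _, congrArg Prod.snd this⟩
  · rintro ⟨p, hp, rfl⟩
    obtain ⟨i, hi, rfl⟩ := List.getElem_of_mem hp
    exact ⟨⟨i, by omega⟩, l[i].1, hl.lt _ hp, toFactorisation_apply hlen _⟩

theorem disjoint_and_union_eq_univ (hn : 2 ≤ n) {τ : Fin (n - 1) → Equiv.Perm (Fin n)}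
    (hτ : τ ∈ increasingFactorisations n) :
    Disjoint (leftEnds τ) (rightEnds τ) ∧ leftEnds τ ∪ rightEnds τ = Set.univ := by
  rw [← image_toFactorisation (by omega)] at hτ
  obtain ⟨l, hl, rfl⟩ := hτ
  rw [leftEnds_toFactorisation hl, rightEnds_toFactorisation hl]
  refine ⟨Finset.disjoint_coe.2 hl.disjoint_and_cover.1, ?_⟩
  rw [← Finset.coe_union, hl.lefts_union_rights (by simpa using hn), Finset.coe_univ]

theorem ncard_increasingFactorisations (m : ℕ) :
    ((increasingFactorisations (m + 2)).ncard : ℚ) =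
      ((2 * (m + 1)).choose m : ℚ) / (m + 1) := by
  rw [← image_toFactorisation (by omega), injOn_toFactorisation.ncard_image,
    Set.ncard_eq_toFinset_card _ (finite_setOf_isIncFact _), ← eval_one_narayana]
  have := card_incFacts (s := (Finset.univ : Finset (Fin (m + 2)))) Finset.univ_nonempty
  rwa [Finset.card_univ, Fintype.card_fin] at this

theorem ncard_increasingFactorisations_inter (m k : ℕ) :
    ((increasingFactorisations (m + 2) ∩ {τ | (leftEnds τ).ncard = k}).ncard : ℚ) =
      (narayana (m + 2)).coeff k := by
  have h : increasingFactorisations (m + 2) ∩ {τ | (leftEnds τ).ncard = k} =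
      toFactorisation '' ↑((incFacts (Finset.univ : Finset (Fin (m + 2)))).filter
        (fun l => (lefts l).card = k)) := by
    rw [← image_toFactorisation (by omega)]
    ext τ
    constructor
    · rintro ⟨⟨l, hl, rfl⟩, hk⟩
      refine ⟨l, ?_, rfl⟩
      rw [Set.mem_ofPred_eq, leftEnds_toFactorisation hl, Set.ncard_coe_finset] at hk
      simpa [mem_incFacts] using ⟨hl, hk⟩
    · rintro ⟨l, hl, rfl⟩
      simp only [Finset.coe_filter, mem_incFacts, Set.mem_ofPred_eq] at hl
      refine ⟨⟨l, hl.1, rfl⟩, ?_⟩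
      rw [Set.mem_ofPred_eq, leftEnds_toFactorisation hl.1, Set.ncard_coe_finset, hl.2]
  rw [h, Set.InjOn.ncard_image, Set.ncard_coe_finset, card_incFacts_filter
    Finset.univ_nonempty, Finset.card_univ, Fintype.card_fin]
  refine injOn_toFactorisation.mono fun l hl => ?_
  simp only [Finset.coe_filter, mem_incFacts, Set.mem_ofPred_eq] at hl
  exact hl.1

theorem uniformIncreasing_real (n : ℕ) (t : Set (Fin (n - 1) → Equiv.Perm (Fin n))) :
    (uniformIncreasing n).real t =
      ((increasingFactorisations n ∩ t).ncard : ℝ) / (increasingFactorisations n).ncard := by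
  rw [uniformIncreasing, uniformOn, measureReal_def, cond_apply (Set.toFinite _).measurableSet,
    Measure.count_apply_finite _ (Set.toFinite _), Measure.count_apply_finite _ (Set.toFinite _),
    ← Set.ncard_eq_toFinset_card, ← Set.ncard_eq_toFinset_card]
  simp [div_eq_inv_mul]

/-- The number of left ends has a hypergeometric distribution. -/
theorem uniformIncreasing_real_ncard_eq (m k : ℕ) :
    (uniformIncreasing (m + 2)).real {τ | (leftEnds τ).ncard = k + 1} =
      ((m + 1).choose (k + 1) : ℝ) * (m + 1).choose k / (2 * (m + 1)).choose m := by
  have h1 : ((increasingFactorisations (m + 2)).ncard : ℝ) =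
      ((2 * (m + 1)).choose m : ℝ) / (m + 1) := by
    have := congrArg (fun q : ℚ => (q : ℝ)) (ncard_increasingFactorisations m)
    push_cast at this
    exact this
  have h2 : ((increasingFactorisations (m + 2) ∩ {τ | (leftEnds τ).ncard = k + 1}).ncard : ℝ) =
      ((m + 1).choose (k + 1) : ℝ) * (m + 1).choose k / (m + 1) := by
    have := ncard_increasingFactorisations_inter m (k + 1)
    rw [coeff_narayana_succ, narayanaCoeff] at this
    have := congrArg (fun q : ℚ => (q : ℝ)) this
    push_cast at this
    exact this
  rw [uniformIncreasing_real, h1, h2]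
  have : ((2 * (m + 1)).choose m : ℝ) ≠ 0 := by
    exact_mod_cast (Nat.choose_pos (by omega)).ne'
  field_simp

end transfer

/-! ### Local asymptotics of binomial coefficients -/

section deMoivreLaplace

open Topology Real

/-- Second-order expansion of the binary entropy at its maximum. -/
theorem abs_entropy_sub_sq_le {δ : ℝ} (h : |δ| ≤ 1 / 2) :
    |(1 + δ) * log (1 + δ) + (1 - δ) * log (1 - δ) - δ ^ 2| ≤ 6 * |δ| ^ 3 := by
  have key : ∀ y : ℝ, |y| ≤ 1 / 2 → |y + y ^ 2 / 2 + log (1 - y)| ≤ 2 * |y| ^ 3 := by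
    intro y hy
    have h1 := Real.abs_log_sub_add_sum_range_le (x := y) (by linarith) 2
    simp only [Finset.sum_range_succ, Finset.sum_range_zero] at h1
    norm_num at h1
    refine h1.trans ?_
    rw [div_le_iff₀ (by linarith)]
    nlinarith [pow_nonneg (abs_nonneg y) 3]
  have h1 := key δ h
  have h2 := key (-δ) (by rwa [abs_neg])
  rw [abs_neg, sub_neg_eq_add] at h2
  have e : (1 + δ) * log (1 + δ) + (1 - δ) * log (1 - δ) - δ ^ 2 =
      (1 + δ) * (-δ + (-δ) ^ 2 / 2 + log (1 + δ)) +
        (1 - δ) * (δ + δ ^ 2 / 2 + log (1 - δ)) := by ring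
  obtain ⟨hl, hr⟩ := abs_le.1 h
  rw [e]
  refine (abs_add_le _ _).trans ?_
  rw [abs_mul, abs_mul, abs_of_nonneg (by linarith : 0 ≤ 1 + δ),
    abs_of_nonneg (by linarith : 0 ≤ 1 - δ)]
  have h3 := mul_le_mul_of_nonneg_left h2 (by linarith : 0 ≤ 1 + δ)
  have h4 := mul_le_mul_of_nonneg_left h1 (by linarith : 0 ≤ 1 - δ)
  nlinarith [pow_nonneg (abs_nonneg δ) 3]

theorem tendsto_mul_entropy {ι : Type*} {l : Filter ι} {m δ : ι → ℝ} {c : ℝ}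
    (hδ : Tendsto δ l (𝓝 0)) (hm : ∀ᶠ i in l, 0 ≤ m i)
    (hc : Tendsto (fun i => m i * δ i ^ 2) l (𝓝 c)) :
    Tendsto (fun i => m i * ((1 + δ i) * log (1 + δ i) + (1 - δ i) * log (1 - δ i))) l (𝓝 c) := by
  have hδ' : Tendsto (fun i => |δ i|) l (𝓝 0) := by simpa using hδ.abs
  have hz : Tendsto (fun i => 6 * |δ i| * (m i * δ i ^ 2)) l (𝓝 0) := by
    simpa using (hδ'.const_mul 6).mul hc
  have hd : Tendsto (fun i => m i * ((1 + δ i) * log (1 + δ i) + (1 - δ i) * log (1 - δ i))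
      - m i * δ i ^ 2) l (𝓝 0) := by
    refine squeeze_zero_norm' ?_ hz
    filter_upwards [hm, hδ'.eventually (ge_mem_nhds (by norm_num : (0 : ℝ) < 1 / 2))] with i h1 h2
    rw [← mul_sub, norm_mul, Real.norm_of_nonneg h1, Real.norm_eq_abs]
    refine (mul_le_mul_of_nonneg_left (abs_entropy_sub_sq_le h2) h1).trans_eq ?_
    rw [← sq_abs (δ i)]
    ring
  simpa using hd.add hc

/-- A binomial coefficient in terms of the sequence `Stirling.stirlingSeq`, which tends to `√π`,
and of an exponential of an entropy. -/
theorem choose_mul_sqrt_div_eq {m k : ℕ} (hk : 0 < k) (hkm : k < m) :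
    (m.choose k : ℝ) * √m / 2 ^ m =
      Stirling.stirlingSeq m / (Stirling.stirlingSeq k * Stirling.stirlingSeq (m - k)) *
      (√(2 * (k / m : ℝ) * ((m - k : ℕ) / m : ℝ)))⁻¹ *
      exp (-((k : ℝ) * log (2 * k / m) + (m - k : ℕ) * log (2 * (m - k : ℕ) / m))) := by
  obtain ⟨j, rfl⟩ : ∃ j, m = k + j := ⟨m - k, by omega⟩
  have hj : 0 < j := by omega
  rw [Nat.add_sub_cancel_left]
  have hk' : (0 : ℝ) < k := by exact_mod_cast hk
  have hj' : (0 : ℝ) < j := by exact_mod_cast hj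
  have hm' : (0 : ℝ) < ((k + j : ℕ) : ℝ) := by positivity
  have hadd : (k : ℝ) + j = ((k + j : ℕ) : ℝ) := by push_cast; ring
  have hexp : exp (-((k : ℝ) * log (2 * k / (k + j : ℕ)) + j * log (2 * j / (k + j : ℕ)))) =
      ((k + j : ℕ) / 2 : ℝ) ^ (k + j) / ((k : ℝ) ^ k * (j : ℝ) ^ j) := by
    rw [exp_neg, exp_add, mul_comm (k : ℝ), mul_comm (j : ℝ), exp_mul, exp_mul,
      exp_log (by positivity), exp_log (by positivity), rpow_natCast, rpow_natCast]
    rw [div_pow, div_pow, mul_pow, mul_pow, div_pow, pow_add, pow_add]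
    field_simp
  rw [hexp, Nat.cast_add_choose]
  have hfac : ∀ n : ℕ, 0 < n → (n.factorial : ℝ) =
      Stirling.stirlingSeq n * (√(2 * n) * (n / exp 1) ^ n) := by
    intro n hn
    have : (0 : ℝ) < n := by exact_mod_cast hn
    rw [Stirling.stirlingSeq, div_mul_cancel₀]
    positivity
  have hpos : ∀ n : ℕ, 0 < n → 0 < Stirling.stirlingSeq n := by
    intro n hn
    obtain ⟨n, rfl⟩ := Nat.exists_eq_succ_of_ne_zero hn.ne'
    exact Stirling.stirlingSeq'_pos n
  have hs1 := hpos k hk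
  have hs2 := hpos j hj
  have hs3 := hpos (k + j) (by omega)
  rw [hfac k hk, hfac j hj, hfac (k + j) (by omega)]
  generalize Stirling.stirlingSeq k = s1 at *
  generalize Stirling.stirlingSeq j = s2 at *
  generalize Stirling.stirlingSeq (k + j) = s3 at *
  generalize ((k + j : ℕ) : ℝ) = M at *
  have hsq : √(2 * (k / M) * (j / M)) = √(2 * k) * √(2 * j) / (√(2 * M) * √M) := by
    rw [← sqrt_mul (by positivity), ← sqrt_mul (by positivity), ← sqrt_div (by positivity)]
    congr 1
    field_simp
  rw [hsq, div_pow, div_pow, div_pow, div_pow, pow_add (exp 1)]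
  field_simp

/-- **De Moivre–Laplace**: local asymptotics of binomial coefficients around the centre. -/
theorem tendsto_choose_mul_sqrt_div {ι : Type*} {l : Filter ι} {m k : ι → ℕ} {x : ℝ}
    (hm : Tendsto m l atTop)
    (hx : Tendsto (fun i => ((k i : ℝ) - m i / 2) / √(m i)) l (𝓝 x)) :
    Tendsto (fun i => ((m i).choose (k i) : ℝ) * √(m i) / 2 ^ (m i)) l
      (𝓝 (√(2 / π) * exp (-2 * x ^ 2))) := by
  have hmR : Tendsto (fun i => (m i : ℝ)) l atTop := tendsto_natCast_atTop_atTop.comp hm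
  have hsq : Tendsto (fun i => √(m i : ℝ)) l atTop := tendsto_sqrt_atTop.comp hmR
  -- `δ` is defined by `2 k / m = 1 + δ`
  let δ : ι → ℝ := fun i => 2 * (((k i : ℝ) - m i / 2) / √(m i)) / √(m i)
  have hδ : Tendsto δ l (𝓝 0) := (hx.const_mul 2).div_atTop hsq
  have hpos : ∀ᶠ i in l, 0 < (m i : ℝ) := hmR.eventually_gt_atTop 0
  have hδeq : ∀ᶠ i in l, (k i : ℝ) = m i * (1 + δ i) / 2 := by
    filter_upwards [hpos] with i hi
    have h1 : √(m i : ℝ) ≠ 0 := (sqrt_pos.2 hi).ne'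
    have h2 : √(m i : ℝ) * √(m i : ℝ) = m i := mul_self_sqrt hi.le
    have h3 : δ i = 2 * (k i - m i / 2) / m i := by
      simp only [δ]
      rw [mul_div_assoc', div_div, h2]
    rw [h3]
    field_simp
    ring
  have hbd : ∀ᶠ i in l, 0 < k i ∧ k i < m i := by
    filter_upwards [hpos, hδeq, hδ.eventually (gt_mem_nhds (by norm_num : (0 : ℝ) < 1)),
      hδ.eventually (lt_mem_nhds (by norm_num : (-1 : ℝ) < 0))] with i h1 h2 h3 h4
    constructor
    · have : (0 : ℝ) < k i := by rw [h2]; nlinarith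
      exact_mod_cast this
    · have : (k i : ℝ) < m i := by rw [h2]; nlinarith
      exact_mod_cast this
  have hjeq : ∀ᶠ i in l, ((m i - k i : ℕ) : ℝ) = m i * (1 - δ i) / 2 := by
    filter_upwards [hbd, hδeq] with i h1 h2
    rw [Nat.cast_sub h1.2.le, h2]
    ring
  have hlim1 : Tendsto (fun i => 1 + δ i) l (𝓝 1) := by simpa using hδ.const_add 1
  have hlim2 : Tendsto (fun i => 1 - δ i) l (𝓝 1) := by simpa using hδ.const_sub 1
  have hk : Tendsto k l atTop := by
    rw [← tendsto_natCast_atTop_iff (R := ℝ)]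
    refine Tendsto.congr' (hδeq.mono fun i h => h.symm) ?_
    exact (hmR.atTop_mul_pos one_pos hlim1).atTop_div_const two_pos
  have hj : Tendsto (fun i => m i - k i) l atTop := by
    rw [← tendsto_natCast_atTop_iff (R := ℝ)]
    refine Tendsto.congr' (hjeq.mono fun i h => h.symm) ?_
    exact (hmR.atTop_mul_pos one_pos hlim2).atTop_div_const two_pos
  have hst := Stirling.tendsto_stirlingSeq_sqrt_pi
  have hsp : √π ≠ 0 := (sqrt_pos.2 pi_pos).ne'
  have F1 : Tendsto (fun i => Stirling.stirlingSeq (m i) /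
      (Stirling.stirlingSeq (k i) * Stirling.stirlingSeq (m i - k i))) l
      (𝓝 (√π / (√π * √π))) :=
    (hst.comp hm).div ((hst.comp hk).mul (hst.comp hj)) (mul_ne_zero hsp hsp)
  have F2 : Tendsto (fun i => (√(2 * (k i / m i : ℝ) * ((m i - k i : ℕ) / m i : ℝ)))⁻¹) l
      (𝓝 (√(2 * (1 / 2) * (1 / 2)))⁻¹) := by
    have hk2 : Tendsto (fun i => (k i / m i : ℝ)) l (𝓝 (1 / 2)) := by
      refine (hlim1.div_const 2).congr' ?_
      filter_upwards [hδeq, hpos] with i h1 h2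
      rw [h1]
      field_simp
    have hj2 : Tendsto (fun i => ((m i - k i : ℕ) / m i : ℝ)) l (𝓝 (1 / 2)) := by
      refine (hlim2.div_const 2).congr' ?_
      filter_upwards [hjeq, hpos] with i h1 h2
      rw [h1]
      field_simp
    exact (((hk2.const_mul 2).mul hj2).sqrt).inv₀ (by positivity)
  have F3 : Tendsto (fun i => exp (-((k i : ℝ) * log (2 * k i / m i) +
      (m i - k i : ℕ) * log (2 * (m i - k i : ℕ) / m i)))) l (𝓝 (exp (-((4 * x ^ 2) / 2)))) := by
    have hc : Tendsto (fun i => (m i : ℝ) * δ i ^ 2) l (𝓝 (4 * x ^ 2)) := by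
      refine ((hx.pow 2).const_mul 4).congr' ?_
      filter_upwards [hpos] with i hi
      have h2 : √(m i : ℝ) ^ 2 = m i := sq_sqrt hi.le
      simp only [δ]
      rw [div_pow, div_pow, mul_pow, div_pow, h2]
      field_simp
      norm_num
    have := ((tendsto_mul_entropy hδ (hpos.mono fun i h => h.le) hc).div_const 2).neg
    refine (continuous_exp.tendsto _).comp (this.congr' ?_)
    filter_upwards [hδeq, hjeq, hpos] with i h1 h2 h3
    rw [h1, h2]
    have e1 : 2 * ((m i : ℝ) * (1 + δ i) / 2) / m i = 1 + δ i := by field_simp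
    have e2 : 2 * ((m i : ℝ) * (1 - δ i) / 2) / m i = 1 - δ i := by field_simp
    rw [e1, e2]
    ring
  have hval : √(2 / π) * exp (-2 * x ^ 2) =
      √π / (√π * √π) * (√(2 * (1 / 2) * (1 / 2)))⁻¹ * exp (-((4 * x ^ 2) / 2)) := by
    congr 1
    · rw [sqrt_div (by norm_num), ← sqrt_inv]
      norm_num
      field_simp
    · congr 1
      ring
  rw [hval]
  refine ((F1.mul F2).mul F3).congr' ?_
  filter_upwards [hbd] with i hi
  rw [choose_mul_sqrt_div_eq hi.1 hi.2]

end deMoivreLaplace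

/-! ### From a local limit theorem to convergence of expectations -/

section localLimit

open Topology

/-- Scheffé's lemma, tested against a bounded convergent sequence: if probability densities `g n`
converge pointwise to a probability density `φ`, so do the integrals against `f n → f`. -/
theorem tendsto_integral_mul_of_tendsto_density {α : Type*} [MeasurableSpace α] {μ : Measure α}
    {g f : ℕ → α → ℝ} {φ F : α → ℝ} {c : ℝ}
    (hg : ∀ n, Integrable (g n) μ) (hg0 : ∀ n x, 0 ≤ g n x) (hg1 : ∀ n, ∫ x, g n x ∂μ = 1)
    (hφ : Integrable φ μ) (hφ0 : ∀ x, 0 ≤ φ x) (hφ1 : ∫ x, φ x ∂μ = 1)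
    (hlim : ∀ x, Tendsto (fun n => g n x) atTop (𝓝 (φ x)))
    (hf : ∀ n, AEStronglyMeasurable (f n) μ) (hfc : ∀ n x, |f n x| ≤ c)
    (hflim : ∀ x, Tendsto (fun n => f n x) atTop (𝓝 (F x))) :
    Tendsto (fun n => ∫ x, g n x * f n x ∂μ) atTop (𝓝 (∫ x, φ x * F x ∂μ)) := by
  have hmin : ∀ n, Integrable (fun x => min (g n x) (φ x)) μ := fun n => (hg n).inf hφ
  have hminlim : ∀ x, Tendsto (fun n => min (g n x) (φ x)) atTop (𝓝 (φ x)) := fun x => by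
    simpa using (hlim x).min (tendsto_const_nhds (x := φ x))
  have hmin0 : ∀ n x, 0 ≤ min (g n x) (φ x) := fun n x => le_min (hg0 n x) (hφ0 x)
  have hprod : ∀ n, ∀ h : α → ℝ, Integrable h μ → Integrable (fun x => h x * f n x) μ :=
    fun n h hh => hh.mul_bdd (hf n) (ae_of_all _ (hfc n))
  -- The part of `g n` below `φ` is handled by dominated convergence ...
  have h1 : Tendsto (fun n => ∫ x, min (g n x) (φ x) * f n x ∂μ) atTop
      (𝓝 (∫ x, φ x * F x ∂μ)) := by
    refine tendsto_integral_of_dominated_convergence (fun x => φ x * c)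
      (fun n => (hprod n _ (hmin n)).aestronglyMeasurable) (hφ.mul_const c) ?_ ?_
    · refine fun n => ae_of_all _ fun x => ?_
      rw [Real.norm_eq_abs, abs_mul, abs_of_nonneg (hmin0 n x)]
      exact mul_le_mul (min_le_right _ _) (hfc n x) (abs_nonneg _) (hφ0 x)
    · exact ae_of_all _ fun x => (hminlim x).mul (hflim x)
  have h2 : Tendsto (fun n => ∫ x, min (g n x) (φ x) ∂μ) atTop (𝓝 1) := by
    rw [← hφ1]
    refine tendsto_integral_of_dominated_convergence φ
      (fun n => (hmin n).aestronglyMeasurable) hφ ?_ (ae_of_all _ hminlim)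
    refine fun n => ae_of_all _ fun x => ?_
    rw [Real.norm_eq_abs, abs_of_nonneg (hmin0 n x)]
    exact min_le_right _ _
  -- ... and the part above `φ` has vanishing mass, as the total masses agree.
  have h3 : Tendsto (fun n => ∫ x, (g n x - min (g n x) (φ x)) * f n x ∂μ) atTop (𝓝 0) := by
    have h4 : Tendsto (fun n => (1 - ∫ x, min (g n x) (φ x) ∂μ) * c) atTop (𝓝 0) := by
      simpa using (h2.const_sub 1).mul_const c
    refine squeeze_zero_norm (fun n => ?_) h4
    rw [← hg1 n, ← integral_sub (hg n) (hmin n), ← integral_mul_const]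
    refine norm_integral_le_of_norm_le (((hg n).sub (hmin n)).mul_const c)
      (ae_of_all _ fun x => ?_)
    have : 0 ≤ g n x - min (g n x) (φ x) := sub_nonneg.2 (min_le_left _ _)
    rw [Real.norm_eq_abs, abs_mul, abs_of_nonneg this]
    exact mul_le_mul_of_nonneg_left (hfc n x) this
  have h5 := h1.add h3
  rw [add_zero] at h5
  refine h5.congr fun n => ?_
  have h6 : Integrable (fun x => (g n x - min (g n x) (φ x)) * f n x) μ :=
    hprod n _ ((hg n).sub (hmin n))
  rw [← integral_add (hprod n _ (hmin n)) h6]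
  congr 1
  ext x
  ring

theorem integrable_and_integral_comp_floor {h : ℤ → ℝ} {s : Finset ℤ} (hs : ∀ z ∉ s, h z = 0) :
    Integrable (fun u : ℝ => h ⌊u⌋) ∧ ∫ u : ℝ, h ⌊u⌋ = ∑ z ∈ s, h z := by
  have heq : (fun u : ℝ => h ⌊u⌋) =
      fun u => ∑ z ∈ s, (Set.Ico (z : ℝ) (z + 1)).indicator (fun _ => h z) u := by
    ext u
    have : ∀ z ∈ s, (Set.Ico (z : ℝ) (z + 1)).indicator (fun _ => h z) u =
        if ⌊u⌋ = z then h z else 0 := by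
      intro z _
      rw [Set.indicator_apply]
      simp only [Set.mem_Ico, ← Int.floor_eq_iff]
    rw [Finset.sum_congr rfl this, Finset.sum_ite_eq]
    split_ifs with hu
    · rfl
    · exact hs _ hu
  have hint : ∀ z ∈ s, Integrable ((Set.Ico (z : ℝ) (z + 1)).indicator (fun _ => h z)) :=
    fun z _ => (integrableOn_const (by simp)).integrable_indicator measurableSet_Ico
  rw [heq]
  refine ⟨integrable_finsetSum _ hint, ?_⟩
  rw [integral_finsetSum _ hint]
  refine Finset.sum_congr rfl fun z _ => ?_
  rw [integral_indicator_const _ measurableSet_Ico]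
  simp

theorem integrable_and_integral_comp_floor_affine {h : ℤ → ℝ} {s : Finset ℤ} (hs : ∀ z ∉ s, h z = 0)
    (a : ℝ) {σ : ℝ} (hσ : 0 < σ) :
    Integrable (fun x : ℝ => h ⌊a + σ * x⌋) ∧ ∫ x : ℝ, h ⌊a + σ * x⌋ = σ⁻¹ * ∑ z ∈ s, h z := by
  obtain ⟨h1, h2⟩ := integrable_and_integral_comp_floor hs
  constructor
  · exact (h1.comp_add_left a).comp_mul_left' hσ.ne'
  · rw [Measure.integral_comp_mul_left (fun u => h ⌊a + u⌋) σ,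
      integral_add_left_eq_self (fun u => h ⌊u⌋), h2, smul_eq_mul, abs_of_pos (inv_pos.2 hσ)]

/-- A local limit theorem for integer-valued random variables implies convergence of expectations
of bounded continuous functions of the normalised variables. -/
theorem tendsto_integral_of_local_limit {Ω : ℕ → Type*} [∀ n, MeasurableSpace (Ω n)]
    {P : ∀ n, Measure (Ω n)} [∀ n, IsProbabilityMeasure (P n)]
    {Z : ∀ n, Ω n → ℤ} (hZ : ∀ n, AEMeasurable (Z n) (P n))
    {s : ℕ → Finset ℤ} (hs : ∀ n ω, Z n ω ∈ s n)
    {a σ : ℕ → ℝ} (hσ : ∀ n, 0 < σ n) (hσlim : Tendsto σ atTop atTop)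
    {φ : ℝ → ℝ} (hφ : Integrable φ) (hφ0 : ∀ x, 0 ≤ φ x) (hφ1 : ∫ x, φ x = 1)
    (hlim : ∀ x, Tendsto (fun n => σ n * (P n).real {ω | Z n ω = ⌊a n + σ n * x⌋}) atTop (𝓝 (φ x)))
    {f : ℝ → ℝ} (hf : Continuous f) {c : ℝ} (hfc : ∀ x, |f x| ≤ c) :
    Tendsto (fun n => ∫ ω, f ((Z n ω - a n) / σ n) ∂(P n)) atTop (𝓝 (∫ x, φ x * f x)) := by
  let p : ∀ n, ℤ → ℝ := fun n z => (P n).real {ω | Z n ω = z}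
  have hp0 : ∀ n, ∀ z ∉ s n, p n z = 0 := by
    intro n z hz
    have : {ω | Z n ω = z} = ∅ := by
      ext ω
      simp only [Set.mem_ofPred_eq, Set.mem_empty_iff_false, iff_false]
      rintro rfl
      exact hz (hs n ω)
    simp only [p, this, measureReal_empty]
  have hexp : ∀ n, ∀ h : ℤ → ℝ, ∫ ω, h (Z n ω) ∂(P n) = ∑ z ∈ s n, p n z * h z := by
    intro n h
    have hnull : ∀ z, NullMeasurableSet {ω | Z n ω = z} (P n) := fun z =>
      (hZ n).nullMeasurableSet_preimage (measurableSet_singleton z)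
    have heq : (fun ω => h (Z n ω)) =
        fun ω => ∑ z ∈ s n, {ω | Z n ω = z}.indicator (fun _ => h z) ω := by
      ext ω
      simp only [Set.indicator_apply, Set.mem_ofPred_eq]
      rw [Finset.sum_ite_eq, if_pos (hs n ω)]
    rw [heq, integral_finsetSum]
    · refine Finset.sum_congr rfl fun z _ => ?_
      rw [integral_indicator₀ (hnull z), setIntegral_const, smul_eq_mul]
    · exact fun z _ => (integrable_const _).indicator₀ (hnull z)
  have hsum : ∀ n, ∑ z ∈ s n, p n z = 1 := by
    intro n
    have := hexp n (fun _ => 1)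
    simpa using this.symm
  have key : ∀ n, ∀ h : ℤ → ℝ, ∫ x, σ n * p n ⌊a n + σ n * x⌋ * h ⌊a n + σ n * x⌋ =
      ∑ z ∈ s n, p n z * h z := by
    intro n h
    have := (integrable_and_integral_comp_floor_affine (h := fun z => σ n * p n z * h z) (s := s n)
      (fun z hz => by rw [hp0 n z hz]; ring) (a n) (hσ n)).2
    rw [this, Finset.mul_sum]
    refine Finset.sum_congr rfl fun z _ => ?_
    have := (hσ n).ne'
    field_simp
  have hmain := tendsto_integral_mul_of_tendsto_density (μ := (volume : Measure ℝ))
    (g := fun n x => σ n * p n ⌊a n + σ n * x⌋)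
    (f := fun n x => f ((⌊a n + σ n * x⌋ - a n) / σ n)) (φ := φ) (F := f) (c := c)
    (fun n => (integrable_and_integral_comp_floor_affine (h := fun z => σ n * p n z) (s := s n)
      (fun z hz => by rw [hp0 n z hz, mul_zero]) (a n) (hσ n)).1)
    (fun n x => mul_nonneg (hσ n).le measureReal_nonneg)
    (fun n => by
      have := key n (fun _ => 1)
      simpa [hsum n] using this)
    hφ hφ0 hφ1 hlim
    (fun n => by
      refine (hf.measurable.comp ?_).aestronglyMeasurable
      refine Measurable.div_const (Measurable.sub_const ?_ _) _
      exact measurable_from_top.comp (Int.measurable_floor.comp (by fun_prop)))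
    (fun n x => hfc _)
    (fun x => by
      refine (hf.tendsto x).comp ?_
      have h1 : Tendsto (fun n => x - (σ n)⁻¹) atTop (𝓝 x) := by
        simpa using (tendsto_inv_atTop_zero.comp hσlim).const_sub x
      refine tendsto_of_tendsto_of_tendsto_of_le_of_le h1 tendsto_const_nhds ?_ ?_
      · intro n
        have := Int.lt_floor_add_one (a n + σ n * x)
        have hσn := hσ n
        simp only
        rw [le_div_iff₀ hσn, sub_mul, inv_mul_cancel₀ hσn.ne']
        linarith
      · intro n
        have := Int.floor_le (a n + σ n * x)
        have hσn := hσ n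
        simp only
        rw [div_le_iff₀ hσn]
        linarith)
  refine hmain.congr fun n => ?_
  rw [hexp n (fun z => f ((z - a n) / σ n))]
  exact key n (fun z => f ((z - a n) / σ n))

end localLimit

/-! ### The limit theorem -/

section limit

open Topology Real

/-- The local limit of the hypergeometric probabilities, for `m + 2` in place of `n`. -/
theorem tendsto_hypergeometric {x : ℝ} {k : ℕ → ℕ}
    (hk : Tendsto (fun m : ℕ => ((k m + 1 : ℕ) - ((m + 1 : ℕ) : ℝ) / 2) / √((m + 1 : ℕ) : ℝ))
      atTop (𝓝 x)) :
    Tendsto (fun m : ℕ => √((m + 2 : ℕ) : ℝ) *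
      (((m + 1).choose (k m + 1) : ℝ) * (m + 1).choose (k m) / (2 * (m + 1)).choose m))
      atTop (𝓝 (gaussianPDFReal 0 (1 / 8) x)) := by
  have hM : Tendsto (fun m : ℕ => m + 1) atTop atTop := tendsto_add_atTop_nat 1
  have h2M : Tendsto (fun m : ℕ => 2 * (m + 1)) atTop atTop :=
    tendsto_atTop_mono (f := fun m => m) (fun m => by omega) tendsto_id
  have hinv : Tendsto (fun m : ℕ => (√((m + 1 : ℕ) : ℝ))⁻¹) atTop (𝓝 0) :=
    tendsto_inv_atTop_zero.comp (tendsto_sqrt_atTop.comp (tendsto_natCast_atTop_atTop.comp hM))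
  have hinv2 : Tendsto (fun m : ℕ => (√((2 * (m + 1) : ℕ) : ℝ))⁻¹) atTop (𝓝 0) :=
    tendsto_inv_atTop_zero.comp (tendsto_sqrt_atTop.comp (tendsto_natCast_atTop_atTop.comp h2M))
  have A := tendsto_choose_mul_sqrt_div (m := fun m => m + 1) (k := fun m => k m + 1) hM hk
  have B := tendsto_choose_mul_sqrt_div (m := fun m => m + 1) (k := k) (x := x) hM (by
    have := hk.sub hinv
    rw [sub_zero] at this
    refine this.congr fun m => ?_
    push_cast
    rw [← one_div, ← sub_div]
    congr 1
    ring)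
  have D := tendsto_choose_mul_sqrt_div (m := fun m => 2 * (m + 1)) (k := fun m => m) (x := 0) h2M
    (by
      have := hinv2.neg
      rw [neg_zero] at this
      refine this.congr fun m => ?_
      push_cast
      rw [← one_div, ← neg_div]
      congr 1
      ring)
  have R : Tendsto (fun m : ℕ => √(2 * (((m + 2 : ℕ) : ℝ) / ((m + 1 : ℕ) : ℝ)))) atTop
      (𝓝 √(2 * 1)) := by
    refine (Tendsto.const_mul 2 ?_).sqrt
    have : Tendsto (fun m : ℕ => 1 + (((m + 1 : ℕ) : ℝ))⁻¹) atTop (𝓝 (1 + 0)) :=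
      (tendsto_inv_atTop_zero.comp (tendsto_natCast_atTop_atTop.comp hM)).const_add 1
    rw [add_zero] at this
    refine this.congr fun m => ?_
    push_cast
    field_simp
    ring
  have hne : √(2 / π) * exp (-2 * 0 ^ 2) ≠ 0 := by positivity
  have hval : gaussianPDFReal 0 (1 / 8) x = (√(2 / π) * exp (-2 * x ^ 2)) *
      (√(2 / π) * exp (-2 * x ^ 2)) / (√(2 / π) * exp (-2 * 0 ^ 2)) * √(2 * 1) := by
    have e1 : exp (-(x - 0) ^ 2 / (2 * (1 / 8))) = exp (-2 * x ^ 2) * exp (-2 * x ^ 2) := by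
      rw [← exp_add]
      congr 1
      ring
    have e2 : (√(2 * π * (1 / 8)))⁻¹ = √(2 / π) * √2 := by
      rw [← sqrt_inv, ← sqrt_mul (by positivity)]
      congr 1
      field_simp
      norm_num
    rw [gaussianPDFReal]
    push_cast
    rw [e1, e2]
    have : √(2 / π) ≠ 0 := by positivity
    simp only [ne_eq, OfNat.ofNat_ne_zero, not_false_eq_true, zero_pow, mul_zero, exp_zero,
      mul_one]
    field_simp
  rw [hval]
  refine (((A.mul B).div D hne).mul R).congr fun m => ?_
  have h1 : √(2 * (((m + 2 : ℕ) : ℝ) / ((m + 1 : ℕ) : ℝ))) =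
      √((m + 2 : ℕ) : ℝ) * √((2 * (m + 1) : ℕ) : ℝ) /
        (√((m + 1 : ℕ) : ℝ) * √((m + 1 : ℕ) : ℝ)) := by
    rw [← sqrt_mul (by positivity), ← sqrt_mul (by positivity), ← sqrt_div (by positivity)]
    congr 1
    push_cast
    field_simp
  simp only [Pi.div_apply]
  rw [h1, pow_mul', sq]
  have h2 : √((m + 1 : ℕ) : ℝ) ≠ 0 := (sqrt_pos.2 (by positivity)).ne'
  have h3 : √((2 * (m + 1) : ℕ) : ℝ) ≠ 0 := (sqrt_pos.2 (by positivity)).ne'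
  have h4 : ((2 * (m + 1)).choose m : ℝ) ≠ 0 := by
    exact_mod_cast (Nat.choose_pos (by omega)).ne'
  field_simp

theorem tendsto_floor_sub_div_sqrt (x : ℝ) :
    Tendsto (fun m : ℕ => ((⌊((m + 2 : ℕ) : ℝ) / 2 + √((m + 2 : ℕ) : ℝ) * x⌋ : ℤ) -
      ((m + 1 : ℕ) : ℝ) / 2) / √((m + 1 : ℕ) : ℝ)) atTop (𝓝 x) := by
  have hM : Tendsto (fun m : ℕ => √((m + 1 : ℕ) : ℝ)) atTop atTop :=
    tendsto_sqrt_atTop.comp (tendsto_natCast_atTop_atTop.comp (tendsto_add_atTop_nat 1))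
  have hinv : Tendsto (fun m : ℕ => (√((m + 1 : ℕ) : ℝ))⁻¹) atTop (𝓝 0) :=
    tendsto_inv_atTop_zero.comp hM
  have R : Tendsto (fun m : ℕ => √((m + 2 : ℕ) : ℝ) / √((m + 1 : ℕ) : ℝ)) atTop (𝓝 1) := by
    have : Tendsto (fun m : ℕ => √(1 + (((m + 1 : ℕ) : ℝ))⁻¹)) atTop (𝓝 √(1 + 0)) :=
      ((tendsto_inv_atTop_zero.comp
        (tendsto_natCast_atTop_atTop.comp (tendsto_add_atTop_nat 1))).const_add 1).sqrt
    rw [add_zero, sqrt_one] at this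
    refine this.congr fun m => ?_
    rw [← sqrt_div (by positivity)]
    congr 1
    push_cast
    field_simp
    ring
  have hlow : Tendsto (fun m : ℕ => √((m + 2 : ℕ) : ℝ) / √((m + 1 : ℕ) : ℝ) * x -
      (1 / 2) * (√((m + 1 : ℕ) : ℝ))⁻¹) atTop (𝓝 x) := by
    have := (R.mul_const x).sub (hinv.const_mul (1 / 2))
    rwa [one_mul, mul_zero, sub_zero] at this
  have hup : Tendsto (fun m : ℕ => √((m + 2 : ℕ) : ℝ) / √((m + 1 : ℕ) : ℝ) * x +
      (1 / 2) * (√((m + 1 : ℕ) : ℝ))⁻¹) atTop (𝓝 x) := by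
    have := (R.mul_const x).add (hinv.const_mul (1 / 2))
    rwa [one_mul, mul_zero, add_zero] at this
  refine tendsto_of_tendsto_of_tendsto_of_le_of_le hlow hup ?_ ?_ <;> intro m <;> simp only
  · have h1 := Int.lt_floor_add_one (((m + 2 : ℕ) : ℝ) / 2 + √((m + 2 : ℕ) : ℝ) * x)
    have h2 : 0 < √((m + 1 : ℕ) : ℝ) := sqrt_pos.2 (by positivity)
    have e : √((m + 2 : ℕ) : ℝ) / √((m + 1 : ℕ) : ℝ) * x - (1 / 2) * (√((m + 1 : ℕ) : ℝ))⁻¹ =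
        (√((m + 2 : ℕ) : ℝ) * x - 1 / 2) / √((m + 1 : ℕ) : ℝ) := by
      field_simp
    rw [e]
    refine div_le_div_of_nonneg_right ?_ h2.le
    generalize √((m + 2 : ℕ) : ℝ) = r at *
    push_cast at *
    linarith
  · have h1 := Int.floor_le (((m + 2 : ℕ) : ℝ) / 2 + √((m + 2 : ℕ) : ℝ) * x)
    have h2 : 0 < √((m + 1 : ℕ) : ℝ) := sqrt_pos.2 (by positivity)
    have e : √((m + 2 : ℕ) : ℝ) / √((m + 1 : ℕ) : ℝ) * x + (1 / 2) * (√((m + 1 : ℕ) : ℝ))⁻¹ =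
        (√((m + 2 : ℕ) : ℝ) * x + 1 / 2) / √((m + 1 : ℕ) : ℝ) := by
      field_simp
    rw [e]
    refine div_le_div_of_nonneg_right ?_ h2.le
    generalize √((m + 2 : ℕ) : ℝ) = r at *
    push_cast at *
    linarith

/-- The local limit theorem for the number of left ends. -/
theorem tendsto_sqrt_mul_uniformIncreasing_real (x : ℝ) :
    Tendsto (fun m : ℕ => √((m + 2 : ℕ) : ℝ) * (uniformIncreasing (m + 2)).real
      {τ | ((leftEnds τ).ncard : ℤ) = ⌊((m + 2 : ℕ) : ℝ) / 2 + √((m + 2 : ℕ) : ℝ) * x⌋})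
      atTop (𝓝 (gaussianPDFReal 0 (1 / 8) x)) := by
  let z : ℕ → ℤ := fun m => ⌊((m + 2 : ℕ) : ℝ) / 2 + √((m + 2 : ℕ) : ℝ) * x⌋
  have hz : ∀ᶠ m in atTop, 1 ≤ z m := by
    have hs : Tendsto (fun m : ℕ => √((m + 2 : ℕ) : ℝ)) atTop atTop :=
      tendsto_sqrt_atTop.comp (tendsto_natCast_atTop_atTop.comp (tendsto_add_atTop_nat 2))
    filter_upwards [hs.eventually_ge_atTop (2 * (1 + |x|))] with m hm
    rw [Int.le_floor, Int.cast_one]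
    have h1 : √((m + 2 : ℕ) : ℝ) * √((m + 2 : ℕ) : ℝ) = ((m + 2 : ℕ) : ℝ) :=
      mul_self_sqrt (by positivity)
    generalize √((m + 2 : ℕ) : ℝ) = r at *
    have hx := abs_nonneg x
    have h2 : 0 ≤ r * (r / 2 - |x| - 1) := mul_nonneg (by linarith) (by linarith)
    have h3 : 0 ≤ r * (|x| + x) := mul_nonneg (by linarith) (by linarith [neg_abs_le x])
    nlinarith
  have hk : ∀ᶠ m in atTop, z m = (((z m - 1).toNat + 1 : ℕ) : ℤ) := by
    filter_upwards [hz] with m hm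
    omega
  have hlim := tendsto_hypergeometric (x := x) (k := fun m => (z m - 1).toNat)
    ((tendsto_floor_sub_div_sqrt x).congr' (by
      filter_upwards [hk] with m hm
      have h : (z m : ℝ) = (((z m - 1).toNat + 1 : ℕ) : ℝ) := by exact_mod_cast hm
      rw [← h]))
  refine hlim.congr' ?_
  filter_upwards [hk] with m hm
  rw [← uniformIncreasing_real_ncard_eq]
  congr 2
  ext τ
  simp only [Set.mem_ofPred_eq]
  change _ ↔ _ = z m
  omega

end limit

theorem proposition2
    {Ω : ℕ → Type*} [∀ n, MeasurableSpace (Ω n)]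
    (P : ∀ n, Measure (Ω n)) [∀ n, IsProbabilityMeasure (P n)]
    (τ : ∀ n, Ω n → Fin (n - 1) → Equiv.Perm (Fin n))
    (hτ : ∀ n, 2 ≤ n → HasLaw (τ n) (uniformIncreasing n) (P n)) :
    (∀ n, 2 ≤ n → ∀ᵐ ω ∂(P n),
      Disjoint (leftEnds (τ n ω)) (rightEnds (τ n ω)) ∧
        leftEnds (τ n ω) ∪ rightEnds (τ n ω) = Set.univ) ∧
    (∀ n, 2 ≤ n → ∀ k, 1 ≤ k → k ≤ n - 1 →
      (P n).real {ω | (leftEnds (τ n ω)).ncard = k} =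
        (n : ℝ) / ((n : ℝ) - 1) * ((n - 1).choose k : ℝ) * ((n - 1).choose (k - 1) : ℝ) *
          ((2 * n - 2).choose (n - 1) : ℝ)⁻¹) ∧
    TendstoInDistribution
      (fun (n : ℕ) (ω : Ω n) => (((leftEnds (τ n ω)).ncard : ℝ) - (n : ℝ) / 2) / √(n : ℝ))
      atTop (id : ℝ → ℝ) P (gaussianReal 0 (1 / 8)) := by
  refine ⟨fun n hn => ?_, fun n hn k hk _ => ?_, ?_⟩
  · have hmeas : ∀ t : Set (Fin (n - 1) → Equiv.Perm (Fin n)), MeasurableSet t :=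
      fun t => (Set.toFinite t).measurableSet
    have h : ∀ᵐ t ∂(uniformIncreasing n), t ∈ increasingFactorisations n :=
      ae_cond_mem (hmeas _)
    rw [← (hτ n hn).map_eq] at h
    filter_upwards [ae_of_ae_map (hτ n hn).aemeasurable h] with ω hω
    exact disjoint_and_union_eq_univ hn hω
  · obtain ⟨m, rfl⟩ : ∃ m, n = m + 2 := ⟨n - 2, by omega⟩
    obtain ⟨j, rfl⟩ : ∃ j, k = j + 1 := ⟨k - 1, by omega⟩
    rw [(hτ (m + 2) hn).measureReal_eq (p := fun t => (leftEnds t).ncard = j + 1)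
      (Set.toFinite _).measurableSet, uniformIncreasing_real_ncard_eq]
    have h1 : ((2 * (m + 1)).choose (m + 1) : ℝ) * (m + 1) =
        (2 * (m + 1)).choose m * (m + 2) := by
      have := Nat.choose_succ_right_eq (2 * (m + 1)) m
      rw [show 2 * (m + 1) - m = m + 2 by omega] at this
      exact_mod_cast this
    have h2 : ((2 * (m + 1)).choose m : ℝ) ≠ 0 := by
      exact_mod_cast (Nat.choose_pos (by omega)).ne'
    have h3 : ((2 * (m + 1)).choose (m + 1) : ℝ) ≠ 0 := by
      exact_mod_cast (Nat.choose_pos (by omega)).ne'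
    rw [show 2 * (m + 2) - 2 = 2 * (m + 1) by omega, show m + 2 - 1 = m + 1 from rfl,
      show j + 1 - 1 = j from rfl]
    have h4 : ((m + 2 : ℕ) : ℝ) - 1 = m + 1 := by push_cast; ring
    rw [h4]
    push_cast
    have h5 : (m : ℝ) + 1 ≠ 0 := by positivity
    field_simp
    linear_combination ((m + 1).choose (j + 1) : ℝ) * (m + 1).choose j * h1
  · have haem : ∀ n, AEMeasurable (τ n) (P n) := by
      intro n
      rcases le_or_gt 2 n with hn | hn
      · exact (hτ n hn).aemeasurable
      · have : IsEmpty (Fin (n - 1)) := by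
          rw [show n - 1 = 0 by omega]
          infer_instance
        exact (measurable_of_subsingleton_codomain _).aemeasurable
    have hmeas : ∀ n, ∀ {β : Type} [MeasurableSpace β]
        (h : (Fin (n - 1) → Equiv.Perm (Fin n)) → β), AEMeasurable (fun ω => h (τ n ω)) (P n) :=
      fun n β _ h => (measurable_of_countable h).comp_aemeasurable (haem n)
    have hX : ∀ n, AEMeasurable
        (fun ω => (((leftEnds (τ n ω)).ncard : ℝ) - (n : ℝ) / 2) / √(n : ℝ)) (P n) := fun n =>
      hmeas n fun t => (((leftEnds t).ncard : ℝ) - (n : ℝ) / 2) / √(n : ℝ)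
    refine ⟨hX, aemeasurable_id, ?_⟩
    refine ProbabilityMeasure.tendsto_iff_forall_integral_tendsto.2 fun f => ?_
    rw [← tendsto_add_atTop_iff_nat 2]
    have hv : (1 / 8 : NNReal) ≠ 0 := by norm_num
    have hmain := tendsto_integral_of_local_limit (Ω := fun m => Ω (m + 2))
      (P := fun m => P (m + 2)) (Z := fun m ω => ((leftEnds (τ (m + 2) ω)).ncard : ℤ))
      (fun m => hmeas (m + 2) fun t => ((leftEnds t).ncard : ℤ))
      (s := fun m => Finset.Icc 0 ((m + 2 : ℕ) : ℤ))
      (fun m ω => by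
        have h := Set.ncard_le_card (leftEnds (τ (m + 2) ω))
        rw [Nat.card_eq_fintype_card, Fintype.card_fin] at h
        rw [Finset.mem_Icc]
        omega)
      (a := fun m => ((m + 2 : ℕ) : ℝ) / 2) (σ := fun m => √((m + 2 : ℕ) : ℝ))
      (fun m => Real.sqrt_pos.2 (by positivity))
      (Real.tendsto_sqrt_atTop.comp (tendsto_natCast_atTop_atTop.comp (tendsto_add_atTop_nat 2)))
      (φ := gaussianPDFReal 0 (1 / 8)) (integrable_gaussianPDFReal _ _)
      (gaussianPDFReal_nonneg _ _) (integral_gaussianPDFReal_eq_one _ hv)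
      (fun x => (tendsto_sqrt_mul_uniformIncreasing_real x).congr fun m => by
        rw [(hτ (m + 2) (by omega)).measureReal_eq (p := fun t => ((leftEnds t).ncard : ℤ) =
          ⌊((m + 2 : ℕ) : ℝ) / 2 + √((m + 2 : ℕ) : ℝ) * x⌋) (Set.toFinite _).measurableSet])
      f.continuous (c := ‖f‖) (fun x => f.norm_coe_le_norm x)
    have hgauss : ∫ x, f x ∂((gaussianReal 0 (1 / 8)).map id) =
        ∫ x, gaussianPDFReal 0 (1 / 8) x * f x := by
      rw [Measure.map_id, integral_gaussianReal_eq_integral_smul hv]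
      rfl
    change Tendsto _ _ (nhds (∫ x, f x ∂((gaussianReal 0 (1 / 8)).map id)))
    rw [hgauss]
    refine hmain.congr fun m => ?_
    change _ = ∫ x, f x ∂((P (m + 2)).map _)
    rw [integral_map (hX (m + 2)) f.continuous.aestronglyMeasurable]
    rfl
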